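/- Let $\mathbb{D}$ be the open unit disk of $\mathbb{C}$. For $\nu\in\mathbb{R}$ let $S_\nu$ be the weighted Dirichlet space, i.e. the Hilbert space of analytic functions $f(z)=\sum_{n\ge 0}a_nz^n$ on $\mathbb{D}$ with $$\|f\|_\nu^2=\sum_{n=0}^\infty |a_n|^2(n+1)^{2\nu}<\infty .$$ A bounded linear operator $T$ on a Banach space $X$ is called recurrent if for every nonempty open set $U\subset X$ there is an integer $k\ge 1$ with $U\cap T^{-k}(U)\neq\emptyset$. Let $\varphi$ be a linear fractional map with $\varphi(\mathbb{D})\subset\mathbb{D}$ that is parabolic (it is not the identity and has exactly one fixed point on the Riemann sphere) and that is not an automorphism of $\mathbb{D}$ (that is, $\varphi(\mathbb{D})\neq\mathbb{D}$). Then, for every $\nu\in\mathbb{R}$, the composition operator $C_\varphi f=f\circ\varphi$ is a bounded linear operator on $S_\nu$ and it is not recurrent. -/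

import Mathlib

open scoped Complex.UnitDisc ComplexConjugate

/-- An operator `T` on `X` is recurrent if for every nonempty open set `U` there is some `k ≥ 1`
such that `U ∩ T⁻ᵏ(U)` is nonempty. -/
def IsRecurrent {X : Type*} [NormedAddCommGroup X] [NormedSpace ℂ X] (T : X →L[ℂ] X) : Prop :=
  ∀ U : Set X, IsOpen U → U.Nonempty → ∃ k : ℕ, 1 ≤ k ∧ (U ∩ (⇑(T ^ k)) ⁻¹' U).Nonempty

/-- The self-map `φ` of the open unit disk is the restriction of a parabolic linear fractional
map of the Riemann sphere `OnePoint ℂ`, on which `GL (Fin 2) ℂ` acts by Möbius transformations. -/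
def IsParabolicLFT (φ : 𝔻 → 𝔻) : Prop :=
  ∃ g : GL (Fin 2) ℂ, g.IsParabolic ∧
    ∀ z : 𝔻, ((φ z : ℂ) : OnePoint ℂ) = g • ((z : ℂ) : OnePoint ℂ)

/-- The linear fractional self-map `φ` is an automorphism of the disk. -/
def IsDiskAutomorphism (φ : 𝔻 → 𝔻) : Prop := Function.Bijective φ

namespace Dirichlet

/-- `f` is analytic on the disk, with Taylor series `∑ aₙ zⁿ`. -/
def HasTaylor (f : 𝔻 → ℂ) (a : ℕ → ℂ) : Prop :=
  ∀ z : 𝔻, HasSum (fun n => a n * (z : ℂ) ^ n) (f z)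

/-- The weight `βₙ = (n + 1) ^ ν`. -/
noncomputable def weight (ν : ℝ) (n : ℕ) : ℝ := ((n : ℝ) + 1) ^ ν

lemma weight_pos (ν : ℝ) (n : ℕ) : 0 < weight ν n := by
  unfold weight; positivity

lemma HasTaylor.unique {f : 𝔻 → ℂ} {a b : ℕ → ℂ} (ha : HasTaylor f a) (hb : HasTaylor f b) :
    a = b := by
  have key : ∀ c : ℕ → ℂ, HasTaylor f c → HasFPowerSeriesAt
      (fun z : ℂ => if h : ‖z‖ < 1 then f (Complex.UnitDisc.mk z h) else 0)
      (FormalMultilinearSeries.ofScalars ℂ c) 0 := by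
    intro c hc
    rw [hasFPowerSeriesAt_iff]
    filter_upwards [Metric.ball_mem_nhds (0 : ℂ) one_pos] with z hz
    have hz' : ‖z‖ < 1 := by simpa using hz
    have := hc (Complex.UnitDisc.mk z hz')
    simpa [hz', FormalMultilinearSeries.coeff_ofScalars, mul_comm] using this
  have := (key a ha).eq_formalMultilinearSeries (key b hb)
  funext n
  simpa using congrArg (fun p => FormalMultilinearSeries.coeff p n) this

/-- The functions analytic on the disk whose Taylor coefficients satisfy
`∑ |aₙ|² βₙ² < ∞`. -/
def submodule (ν : ℝ) : Submodule ℂ (𝔻 → ℂ) where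
  carrier := {f | ∃ a : ℕ → ℂ, HasTaylor f a ∧ Summable fun n => ‖a n‖ ^ 2 * weight ν n ^ 2}
  zero_mem' := ⟨0, fun z => by simp, by simp⟩
  add_mem' := by
    rintro f g ⟨a, ha, hsa⟩ ⟨b, hb, hsb⟩
    refine ⟨a + b, fun z => by simpa [add_mul] using (ha z).add (hb z), ?_⟩
    refine Summable.of_nonneg_of_le (fun n => by positivity) (fun n => ?_)
      ((hsa.mul_left 2).add (hsb.mul_left 2))
    have h1 : ‖a n + b n‖ ^ 2 ≤ 2 * ‖a n‖ ^ 2 + 2 * ‖b n‖ ^ 2 := by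
      nlinarith [norm_add_le (a n) (b n), norm_nonneg (a n + b n), sq_nonneg (‖a n‖ - ‖b n‖)]
    have := mul_le_mul_of_nonneg_right h1 (sq_nonneg (weight ν n))
    simp only [Pi.add_apply]
    linarith
  smul_mem' := by
    rintro c f ⟨a, ha, hsa⟩
    refine ⟨c • a, fun z => by simpa [mul_assoc] using (ha z).mul_left c, ?_⟩
    simpa [mul_pow, mul_assoc] using hsa.mul_left (‖c‖ ^ 2)

/-- The weighted Dirichlet space `S_ν`. It is a type of its own, so that its topology is the one
of its norm and not that of pointwise convergence. -/
def Space (ν : ℝ) : Type := submodule ν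

variable {ν : ℝ}

noncomputable instance : AddCommGroup (Space ν) := inferInstanceAs (AddCommGroup (submodule ν))

noncomputable instance : Module ℂ (Space ν) := inferInstanceAs (Module ℂ (submodule ν))

instance : CoeFun (Space ν) (fun _ => 𝔻 → ℂ) := ⟨fun f => f.1⟩

lemma add_apply (f g : Space ν) (z : 𝔻) : (f + g) z = f z + g z := rfl

lemma smul_apply (c : ℂ) (f : Space ν) (z : 𝔻) : (c • f) z = c * f z := rfl

/-- The Taylor coefficients of `f`. -/
noncomputable def coeff (f : Space ν) : ℕ → ℂ := f.2.choose

lemma hasTaylor_coeff (f : Space ν) : HasTaylor f (coeff f) := f.2.choose_spec.1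

lemma summable_coeff (f : Space ν) : Summable fun n => ‖coeff f n‖ ^ 2 * weight ν n ^ 2 :=
  f.2.choose_spec.2

lemma coeff_add (f g : Space ν) : coeff (f + g) = coeff f + coeff g :=
  (hasTaylor_coeff (f + g)).unique fun z => by
    simpa [add_mul, add_apply] using (hasTaylor_coeff f z).add (hasTaylor_coeff g z)

lemma coeff_smul (c : ℂ) (f : Space ν) : coeff (c • f) = c • coeff f :=
  (hasTaylor_coeff (c • f)).unique fun z => by
    simpa [mul_assoc, smul_apply] using (hasTaylor_coeff f z).mul_left c

lemma eq_zero_of_coeff {f : Space ν} (h : coeff f = 0) : f = 0 := by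
  apply Subtype.ext
  funext z
  have := hasTaylor_coeff f z
  rw [h] at this
  simp only [Pi.zero_apply, zero_mul] at this
  exact this.unique hasSum_zero

lemma summable_inner (f g : Space ν) :
    Summable fun n => coeff g n * conj (coeff f n) * ((weight ν n ^ 2 : ℝ) : ℂ) := by
  refine Summable.of_norm_bounded ((summable_coeff f).add (summable_coeff g)) fun n => ?_
  rw [norm_mul, norm_mul, RCLike.norm_conj, Complex.norm_real, Real.norm_of_nonneg (sq_nonneg _),
    ← add_mul]
  refine mul_le_mul_of_nonneg_right ?_ (sq_nonneg _)
  nlinarith [sq_nonneg (‖coeff f n‖ - ‖coeff g n‖), sq_nonneg ‖coeff f n‖, sq_nonneg ‖coeff g n‖]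

/-- The inner product `∑ bₙ conj(aₙ) βₙ²` of `f = ∑ aₙ zⁿ` and `g = ∑ bₙ zⁿ`, conjugate-linear in
the first variable according to Mathlib's convention. -/
noncomputable abbrev core : InnerProductSpace.Core ℂ (Space ν) where
  inner f g := ∑' n, coeff g n * conj (coeff f n) * ((weight ν n ^ 2 : ℝ) : ℂ)
  conj_inner_symm f g := by
    rw [Complex.conj_tsum]
    refine tsum_congr fun n => ?_
    simp [mul_comm]
  re_inner_nonneg f := by
    have h : ∀ n, coeff f n * conj (coeff f n) * ((weight ν n ^ 2 : ℝ) : ℂ)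
        = ((‖coeff f n‖ ^ 2 * weight ν n ^ 2 : ℝ) : ℂ) := fun n => by
      rw [Complex.mul_conj']; push_cast; ring
    simp only [h]
    rw [← Complex.ofReal_tsum]
    exact tsum_nonneg fun n => by positivity
  add_left f g h := by
    rw [← (summable_inner f h).tsum_add (summable_inner g h)]
    refine tsum_congr fun n => ?_
    simp [coeff_add]; ring
  smul_left f g c := by
    rw [← tsum_mul_left]
    refine tsum_congr fun n => ?_
    simp [coeff_smul]; ring
  definite f hf := by
    have h : ∀ n, coeff f n * conj (coeff f n) * ((weight ν n ^ 2 : ℝ) : ℂ)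
        = ((‖coeff f n‖ ^ 2 * weight ν n ^ 2 : ℝ) : ℂ) := fun n => by
      rw [Complex.mul_conj']; push_cast; ring
    simp only [h] at hf
    rw [← Complex.ofReal_tsum, Complex.ofReal_eq_zero] at hf
    have h0 := ((summable_coeff f).hasSum_iff.2 hf)
    rw [hasSum_zero_iff_of_nonneg fun n => by positivity] at h0
    refine eq_zero_of_coeff (funext fun n => ?_)
    have := congrFun h0 n
    simpa [(weight_pos ν n).ne'] using this

noncomputable instance : NormedAddCommGroup (Space ν) :=
  InnerProductSpace.Core.toNormedAddCommGroup (cd := core)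

noncomputable instance : InnerProductSpace ℂ (Space ν) := InnerProductSpace.ofCore core.toCore

end Dirichlet

/-! The fixed point `η` of `φ` lies on the unit circle. The Cayley transform `u = (η + z) / (η - z)`
carries the disk to the right half-plane and `φ` to a translation `u ↦ u + a`, with `0 < a.re`
because `φ` is not an automorphism (`exists_cayley_translation`).

Boundedness for every `ν`: after a rotation `φ` is the time-one map of the semigroup `u ↦ u + s a`,
whose generator acts on functions as `a/2 (1 - z)² d/dz`. On Taylor coefficients this is a discrete
diffusion. The weights `(n + 1)^(2ν)` have relative increments `O(1/n)`, so the generator is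
dissipative in weighted `ℓ²` up to a bounded error. A Grönwall argument bounds composition on
polynomials (`sum_norm_sq_flow_le`, `exists_sum_parabolicSeries_le`), and passing to the limit in
the Taylor coefficients extends the bound to the whole space (`tendsto_coeff_comp`,
`exists_norm_sq_comp_le`).

Non-recurrence: let `F` be `f` read in the half-plane, so that `C ^ k` turns `F` into `F (u + k a)`.
Take the functional `L f = F^(m)(1)`. Then `L (C ^ k f) = F^(m)(1 + k a)`. Around `1 + k a` there is
a disk of radius of order `k` on which `F` grows at most polynomially in `k`, at a degree depending
only on `ν`. For `m` large Cauchy's estimate therefore gives `O(1/k) ‖f‖`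
(`exists_norm_iteratedDeriv_le`). Some derivative has to be taken, since constants are fixed by `C`.
A nonzero functional whose pullbacks tend to zero in norm excludes recurrence
(`not_isRecurrent_of_tendsto`). -/

/-! ### The half-plane model of a parabolic self-map. -/

lemma IsParabolicLFT.exists_matrix {φ : 𝔻 → 𝔻} (hφ : IsParabolicLFT φ) :
    ∃ A B C D : ℂ, A * D - B * C ≠ 0 ∧ (A - D) ^ 2 + 4 * B * C = 0 ∧ (C = 0 → A = D ∧ B ≠ 0) ∧
      ∀ z : 𝔻, C * z + D ≠ 0 ∧ (φ z : ℂ) * (C * z + D) = A * z + B := by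
  obtain ⟨g, hg, h⟩ := hφ
  refine ⟨g 0 0, g 0 1, g 1 0, g 1 1, ?_, ?_, ?_, fun z => ?_⟩
  · have := g.det_ne_zero
    rwa [Matrix.det_fin_two] at this
  · have h2 := hg.2
    rw [Matrix.discr_fin_two, Matrix.trace_fin_two, Matrix.det_fin_two] at h2
    linear_combination h2
  · intro h10
    exact (Matrix.isParabolic_iff_of_upperTriangular h10).1 hg
  · have hz := h z
    rw [OnePoint.smul_some_eq_ite] at hz
    split_ifs at hz with h0
    · exact absurd hz (OnePoint.coe_ne_infty _)
    · refine ⟨h0, ?_⟩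
      rw [OnePoint.coe_eq_coe] at hz
      rw [hz, div_mul_cancel₀ _ h0]

/-- A parabolic self-map of the disk has a finite fixed point `η`, around which it acts as a
translation of `1 / (z - η)`. -/
lemma IsParabolicLFT.exists_translation {φ : 𝔻 → 𝔻} (hφ : IsParabolicLFT φ) :
    ∃ η c : ℂ, c ≠ 0 ∧ ∀ z : 𝔻, ((φ z : ℂ) - η) * (1 + c * (z - η)) = z - η := by
  obtain ⟨A, B, C, D, hdet, hdisc, hC, h⟩ := hφ.exists_matrix
  -- With `C = 0` the map is a nontrivial Euclidean translation, whose iterates leave the disk.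
  have hC0 : C ≠ 0 := by
    intro hC0
    obtain ⟨rfl, hB⟩ := hC hC0
    subst hC0
    have hA : A ≠ 0 := by rintro rfl; simp at hdet
    have htr : ∀ z : 𝔻, (φ z : ℂ) = z + B / A := fun z => by
      have := (h z).2
      field_simp
      linear_combination this
    have hit : ∀ n : ℕ, ((φ^[n] 0 : 𝔻) : ℂ) = n * (B / A) := by
      intro n
      induction n with
      | zero => simp
      | succ n ih => rw [Function.iterate_succ_apply', htr, ih]; push_cast; ring
    have hpos : 0 < ‖B / A‖ := norm_pos_iff.2 (div_ne_zero hB hA)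
    obtain ⟨n, hn⟩ := exists_nat_gt (1 / ‖B / A‖)
    have h1 := (φ^[n] 0).norm_lt_one
    rw [hit, norm_mul, Complex.norm_natCast] at h1
    rw [div_lt_iff₀ hpos] at hn
    linarith
  have ht : A + D ≠ 0 := by
    intro ht
    apply hdet
    linear_combination (A + D) / 4 * ht - hdisc / 4
  -- `η` is the double root of the fixed point equation `C z² + (D - A) z - B = 0`.
  refine ⟨(A - D) / (2 * C), 2 * C / (A + D), by simp [hC0, ht], fun z => ?_⟩
  obtain ⟨hz, h'⟩ := h z
  have e1 : 1 + 2 * C / (A + D) * ((z : ℂ) - (A - D) / (2 * C)) = 2 * (C * z + D) / (A + D) := by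
    field_simp
    ring
  rw [e1]
  field_simp
  linear_combination 4 * C * h' + hdisc

/-- If `1 < ‖η‖`, then `1 / (z - η)` is bounded on the disk, yet it grows by `c` at each step of the
orbit of `0`. Conversely, the pole `η - 1/c` and its successive preimages `η - 1/((n + 1) c)` all
lie outside the disk and converge to `η`, so `1 ≤ ‖η‖`. -/
lemma norm_fixedPoint_eq_one {φ : 𝔻 → 𝔻} {η c : ℂ} (hc : c ≠ 0)
    (h : ∀ z : 𝔻, ((φ z : ℂ) - η) * (1 + c * (z - η)) = z - η) : ‖η‖ = 1 := by
  apply le_antisymm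
  · by_contra! hη
    have hne : ∀ z : 𝔻, (z : ℂ) - η ≠ 0 := fun z hz => by
      have := z.norm_lt_one
      rw [sub_eq_zero.1 hz] at this
      linarith
    have hit : ∀ n : ℕ, (((φ^[n] 0 : 𝔻) : ℂ) - η)⁻¹ = (-η)⁻¹ + n * c := by
      intro n
      induction n with
      | zero => simp
      | succ n ih =>
        rw [Function.iterate_succ_apply']
        have h1 := h (φ^[n] 0)
        have h2 := hne (φ^[n] 0)
        have h3 := hne (φ (φ^[n] 0))
        have : ((φ (φ^[n] 0) : ℂ) - η)⁻¹ = ((φ^[n] 0 : ℂ) - η)⁻¹ + c := by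
          field_simp
          linear_combination -h1
        rw [this, ih]; push_cast; ring
    have hlow : ∀ z : 𝔻, ‖((z : ℂ) - η)⁻¹‖ ≤ (‖η‖ - 1)⁻¹ := fun z => by
      rw [norm_inv]
      apply inv_anti₀ (by linarith)
      have := norm_sub_norm_le η (z : ℂ)
      rw [norm_sub_rev] at this
      linarith [z.norm_lt_one]
    have hpos : 0 < ‖c‖ := norm_pos_iff.2 hc
    obtain ⟨n, hn⟩ := exists_nat_gt (((‖η‖ - 1)⁻¹ + (‖η‖ - 1)⁻¹) / ‖c‖)
    have h1 := hlow (φ^[n] 0)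
    have h0 := hlow 0
    rw [hit] at h1
    simp only [Complex.UnitDisc.coe_zero, zero_sub] at h0
    have h2 : ‖(n : ℂ) * c‖ ≤ ‖(-η)⁻¹ + n * c‖ + ‖(-η)⁻¹‖ := by
      have := norm_sub_le ((-η)⁻¹ + n * c) (-η)⁻¹
      rwa [add_sub_cancel_left] at this
    rw [norm_mul, Complex.norm_natCast] at h2
    rw [div_lt_iff₀ hpos] at hn
    linarith
  · have hout : ∀ n : ℕ, ∀ z : 𝔻, (z : ℂ) ≠ η - 1 / ((n + 1) * c) := by
      intro n
      induction n with
      | zero =>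
        intro z hz
        have h1 := h z
        rw [hz] at h1
        simp [hc] at h1
      | succ n ih =>
        intro z hz
        apply ih (φ z)
        have h1 := h z
        have hn1 : (n : ℂ) + 1 ≠ 0 := by exact_mod_cast n.succ_ne_zero
        have hn2 : (n : ℂ) + 1 + 1 ≠ 0 := by exact_mod_cast (n + 1).succ_ne_zero
        have e1 : (z : ℂ) - η = -1 / ((n + 1 + 1) * c) := by rw [hz]; push_cast; ring
        rw [e1] at h1
        have e2 : 1 + c * (-1 / (((n : ℂ) + 1 + 1) * c)) = (n + 1) / (n + 1 + 1) := by
          field_simp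
          ring
        rw [e2] at h1
        field_simp at h1 ⊢
        linear_combination h1
    have hlim : Filter.Tendsto (fun n : ℕ => ‖η - 1 / (((n : ℂ) + 1) * c)‖) Filter.atTop
        (nhds ‖η - 0 * c⁻¹‖) := by
      refine (tendsto_const_nhds.sub ?_).norm
      have := (tendsto_one_div_add_atTop_nhds_zero_nat (𝕜 := ℂ)).mul_const c⁻¹
      refine this.congr fun n => ?_
      field_simp
    rw [zero_mul, sub_zero] at hlim
    refine ge_of_tendsto' hlim fun n => ?_
    by_contra! hn
    exact hout n (Complex.UnitDisc.mk _ hn) rfl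

/-- The Cayley transform of the disk sending `η` to infinity has positive real part. -/
lemma re_cayley {η z : ℂ} (hη : ‖η‖ = 1) (hz : ‖z‖ < 1) : 0 < ((η + z) / (η - z)).re := by
  have hne : η - z ≠ 0 := fun h => by rw [sub_eq_zero.1 h] at hη; linarith
  have hN : 0 < Complex.normSq (η - z) := Complex.normSq_pos.2 hne
  have h1 : η.re ^ 2 + η.im ^ 2 = 1 := by
    have := Complex.sq_norm η
    rw [hη, Complex.normSq_apply] at this
    linarith
  have h2 : z.re ^ 2 + z.im ^ 2 < 1 := by
    have := Complex.sq_norm z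
    rw [Complex.normSq_apply] at this
    nlinarith [norm_nonneg z]
  rw [Complex.div_re, ← add_div]
  apply div_pos _ hN
  simp only [Complex.add_re, Complex.sub_re, Complex.add_im, Complex.sub_im]
  nlinarith

lemma one_sub_normSq_cayley_symm {η u : ℂ} (hη : ‖η‖ = 1) (hu : 0 < u.re) :
    1 - ‖η * ((u - 1) / (u + 1))‖ ^ 2 = 4 * u.re / ‖u + 1‖ ^ 2 := by
  have hne : u + 1 ≠ 0 := fun h => by
    have := congrArg Complex.re h
    simp at this
    linarith
  have hN : 0 < Complex.normSq (u + 1) := Complex.normSq_pos.2 hne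
  rw [norm_mul, hη, one_mul, norm_div, div_pow, Complex.sq_norm, Complex.sq_norm,
    eq_div_iff hN.ne', sub_mul, div_mul_cancel₀ _ hN.ne']
  simp only [Complex.normSq_apply, Complex.add_re, Complex.sub_re, Complex.add_im, Complex.sub_im,
    Complex.one_re, Complex.one_im]
  ring

lemma norm_cayley_symm_lt_one {η u : ℂ} (hη : ‖η‖ = 1) (hu : 0 < u.re) :
    ‖η * ((u - 1) / (u + 1))‖ < 1 := by
  have h := one_sub_normSq_cayley_symm hη hu
  have hne : u + 1 ≠ 0 := fun h => by
    have := congrArg Complex.re h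
    simp at this
    linarith
  have : 0 < 4 * u.re / ‖u + 1‖ ^ 2 := by positivity
  nlinarith [norm_nonneg (η * ((u - 1) / (u + 1)))]

lemma cayley_cayley_symm {η u : ℂ} (hη : ‖η‖ = 1) (hu : 0 < u.re) :
    (η + η * ((u - 1) / (u + 1))) / (η - η * ((u - 1) / (u + 1))) = u := by
  have hη0 : η ≠ 0 := fun h => by simp [h] at hη
  have hne : u + 1 ≠ 0 := fun h => by
    have := congrArg Complex.re h
    simp at this
    linarith
  have e : η - η * ((u - 1) / (u + 1)) = 2 * η / (u + 1) := by field_simp; ring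
  rw [e]
  field_simp
  ring

lemma cayley_injective {η : ℂ} (hη : ‖η‖ = 1) {z w : 𝔻}
    (h : (η + z) / (η - z) = (η + w) / (η - w)) : z = w := by
  have hη0 : η ≠ 0 := fun h => by simp [h] at hη
  have hne : ∀ z : 𝔻, η - z ≠ 0 := fun z h => by
    have := z.norm_lt_one
    rw [← sub_eq_zero.1 h, hη] at this
    exact lt_irrefl _ this
  rw [div_eq_div_iff (hne z) (hne w)] at h
  apply Complex.UnitDisc.coe_injective
  apply mul_left_cancel₀ (mul_ne_zero two_ne_zero hη0)
  linear_combination h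

/-- In the half-plane model, a parabolic non-automorphism of the disk is a translation by a number
with positive real part. -/
theorem IsParabolicLFT.exists_cayley_translation {φ : 𝔻 → 𝔻} (hφ : IsParabolicLFT φ)
    (hna : ¬ IsDiskAutomorphism φ) :
    ∃ η a : ℂ, ‖η‖ = 1 ∧ 0 < a.re ∧
      ∀ z : 𝔻, (η + φ z) / (η - φ z) = (η + z) / (η - z) + a := by
  obtain ⟨η, c, hc, h⟩ := hφ.exists_translation
  have hη := norm_fixedPoint_eq_one hc h
  have hne : ∀ z : 𝔻, η - z ≠ 0 := fun z h => by
    have := z.norm_lt_one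
    rw [← sub_eq_zero.1 h, hη] at this
    exact lt_irrefl _ this
  have key : ∀ z : 𝔻, (η + φ z) / (η - φ z) = (η + z) / (η - z) + (-2 * η * c) := fun z => by
    have h1 := hne z
    have h2 := hne (φ z)
    have h3 := h z
    field_simp
    linear_combination 2 * η * h3
  refine ⟨η, -2 * η * c, hη, ?_, key⟩
  -- If `a.re ≤ 0`, subtracting `a` preserves the half-plane, which makes `φ` surjective.
  by_contra! ha
  refine hna ⟨fun z w hzw => cayley_injective hη ?_, fun w => ?_⟩
  · have h1 := key z
    rw [hzw, key w] at h1
    exact (add_right_cancel h1).symm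
  · have hu : 0 < ((η + w) / (η - w) - (-2 * η * c)).re := by
      rw [Complex.sub_re]
      linarith [re_cayley hη w.norm_lt_one]
    refine ⟨Complex.UnitDisc.mk _ (norm_cayley_symm_lt_one hη hu), cayley_injective hη ?_⟩
    rw [key, Complex.UnitDisc.coe_mk, cayley_cayley_symm hη hu]
    ring

/-! ### Regular weights and the energy estimate. -/

/-- Mean value inequality, to be applied to ratios of consecutive integers, which stay in `[1/2,
2]`. -/
lemma exists_abs_rpow_sub_one_le (p : ℝ) :
    ∃ L : ℝ, 0 ≤ L ∧ ∀ x ∈ Set.Icc (1 / 2 : ℝ) 2, |x ^ p - 1| ≤ L * |x - 1| := by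
  have hcont : ContinuousOn (fun x : ℝ => p * x ^ (p - 1)) (Set.Icc (1 / 2) 2) := by
    refine continuousOn_const.mul (continuousOn_id.rpow_const fun x hx => Or.inl ?_)
    have := hx.1
    simp only [id]
    linarith
  obtain ⟨L, hL⟩ := isCompact_Icc.exists_bound_of_continuousOn hcont
  refine ⟨L, (norm_nonneg _).trans (hL 1 (by norm_num)), fun x hx => ?_⟩
  have := Convex.norm_image_sub_le_of_norm_hasDerivWithin_le (f := fun x : ℝ => x ^ p)
    (fun y hy => (Real.hasDerivAt_rpow_const (p := p) (Or.inl (by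
      have := hy.1
      linarith : y ≠ 0))).hasDerivWithinAt) hL (convex_Icc _ _)
    (show (1 : ℝ) ∈ Set.Icc (1 / 2 : ℝ) 2 by norm_num) hx
  simpa using this

/-- A weight on `ℕ` whose relative increments are `O(1 / n)`. -/
structure IsRegularWeight (w : ℕ → ℝ) (K : ℝ) : Prop where
  pos : ∀ n, 0 < w n
  const_nonneg : 0 ≤ K
  sub_le_succ : ∀ n : ℕ, (n + 1) * |w (n + 1) - w n| ≤ K * w (n + 1)
  flux_le : ∀ n : ℕ, |n * w (n + 1) - (n + 1) * w n| ≤ K * w n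
  flux_le_succ : ∀ n : ℕ, |n * w (n + 1) - (n + 1) * w n| ≤ K * w (n + 1)

lemma exists_isRegularWeight (ν : ℝ) :
    ∃ K, IsRegularWeight (fun n => Dirichlet.weight ν n ^ 2) K := by
  obtain ⟨L, hL0, hL⟩ := exists_abs_rpow_sub_one_le (2 * ν)
  have hw : ∀ n, Dirichlet.weight ν n ^ 2 = ((n : ℝ) + 1) ^ (2 * ν) := fun n => by
    rw [Dirichlet.weight, ← Real.rpow_natCast, ← Real.rpow_mul (by positivity)]
    congr 1; push_cast; ring
  have hpos : ∀ n : ℕ, 0 < ((n : ℝ) + 1) ^ (2 * ν) := fun n => by positivity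
  simp only [hw]
  have h1 : ∀ n : ℕ, ((n : ℝ) + 1) * |(((n + 1 : ℕ) : ℝ) + 1) ^ (2 * ν) - ((n : ℝ) + 1) ^ (2 * ν)|
      ≤ L * ((n : ℝ) + 1) ^ (2 * ν) := fun n => by
    have hx := hL (((n + 1 : ℕ) + 1) / (n + 1)) ⟨by
      rw [le_div_iff₀ (by positivity)]; push_cast; linarith [n.cast_nonneg (α := ℝ)], by
      rw [div_le_iff₀ (by positivity)]; push_cast; linarith [n.cast_nonneg (α := ℝ)]⟩
    rw [Real.div_rpow (by positivity) (by positivity), div_sub_one (hpos n).ne', abs_div,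
      abs_of_pos (hpos n), div_le_iff₀ (hpos n), div_sub_one (by positivity), abs_div,
      abs_of_pos (by positivity : (0 : ℝ) < n + 1)] at hx
    have e : |((n + 1 : ℕ) : ℝ) + 1 - (n + 1)| = 1 := by push_cast; simp
    rw [e] at hx
    refine (mul_le_mul_of_nonneg_left hx (by positivity)).trans (le_of_eq ?_)
    field_simp
  have h2 : ∀ n : ℕ, ((n : ℝ) + 1) * |(((n + 1 : ℕ) : ℝ) + 1) ^ (2 * ν) - ((n : ℝ) + 1) ^ (2 * ν)|
      ≤ L * (((n + 1 : ℕ) : ℝ) + 1) ^ (2 * ν) := fun n => by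
    have hx := hL ((n + 1) / ((n + 1 : ℕ) + 1)) ⟨by
      rw [le_div_iff₀ (by positivity)]; push_cast; linarith [n.cast_nonneg (α := ℝ)], by
      rw [div_le_iff₀ (by positivity)]; push_cast; linarith [n.cast_nonneg (α := ℝ)]⟩
    rw [Real.div_rpow (by positivity) (by positivity), div_sub_one (hpos (n + 1)).ne', abs_div,
      abs_of_pos (hpos (n + 1)), div_le_iff₀ (hpos (n + 1)), div_sub_one (by positivity), abs_div,
      abs_of_pos (by positivity : (0 : ℝ) < (n + 1 : ℕ) + 1)] at hx
    have e : |((n : ℝ) + 1) - (((n + 1 : ℕ) : ℝ) + 1)| = 1 := by push_cast; simp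
    rw [e, abs_sub_comm] at hx
    refine (mul_le_mul_of_nonneg_left hx (by positivity)).trans ?_
    have : ((n : ℝ) + 1) * (1 / ((n + 1 : ℕ) + 1)) ≤ 1 := by
      rw [mul_one_div, div_le_one (by positivity)]; push_cast; linarith
    calc _ = (((n : ℝ) + 1) * (1 / ((n + 1 : ℕ) + 1))) * (L * (((n + 1 : ℕ) : ℝ) + 1) ^ (2 * ν)) := by
          ring
      _ ≤ 1 * (L * (((n + 1 : ℕ) : ℝ) + 1) ^ (2 * ν)) :=
          mul_le_mul_of_nonneg_right this (mul_nonneg hL0 (hpos (n + 1)).le)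
      _ = _ := one_mul _
  -- With `w` the weight, `n w(n+1) - (n+1) w(n) = (n+1) (w(n+1) - w(n)) - w(n+1)`.
  have hflux : ∀ n : ℕ, |n * (((n + 1 : ℕ) : ℝ) + 1) ^ (2 * ν) - (n + 1) * ((n : ℝ) + 1) ^ (2 * ν)|
      ≤ (n + 1) * |(((n + 1 : ℕ) : ℝ) + 1) ^ (2 * ν) - ((n : ℝ) + 1) ^ (2 * ν)|
        + (((n + 1 : ℕ) : ℝ) + 1) ^ (2 * ν) := fun n => by
    have := abs_sub ((n + 1) * ((((n + 1 : ℕ) : ℝ) + 1) ^ (2 * ν) - ((n : ℝ) + 1) ^ (2 * ν)))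
      ((((n + 1 : ℕ) : ℝ) + 1) ^ (2 * ν))
    rw [abs_mul, abs_of_pos (by positivity : (0 : ℝ) < n + 1), abs_of_pos (hpos (n + 1))] at this
    refine le_trans (le_of_eq ?_) this
    congr 1; ring
  have hsucc : ∀ n : ℕ, (((n + 1 : ℕ) : ℝ) + 1) ^ (2 * ν) ≤ (L + 1) * ((n : ℝ) + 1) ^ (2 * ν) :=
    fun n => by
    have h3 := le_abs_self ((((n + 1 : ℕ) : ℝ) + 1) ^ (2 * ν) - ((n : ℝ) + 1) ^ (2 * ν))
    have h4 := abs_nonneg ((((n + 1 : ℕ) : ℝ) + 1) ^ (2 * ν) - ((n : ℝ) + 1) ^ (2 * ν))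
    have := h1 n
    nlinarith [n.cast_nonneg (α := ℝ)]
  refine ⟨2 * L + 1, hpos, by positivity, fun n => ?_, fun n => ?_, fun n => ?_⟩
  · exact (h2 n).trans (mul_le_mul_of_nonneg_right (by linarith) (hpos (n + 1)).le)
  · have := hflux n
    have := h1 n
    have := hsucc n
    linarith
  · have := hflux n
    have := h2 n
    have := mul_nonneg hL0 (hpos (n + 1)).le
    linarith

/-- The operator `(1 - z)² d/dz` on coefficient sequences. -/
noncomputable def diffusion (x : ℕ → ℂ) (n : ℕ) : ℂ :=
  (n + 1) * x (n + 1) - 2 * n * x n + ((n - 1 : ℕ) : ℂ) * x (n - 1)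

/-- The interaction between two neighbouring coefficients. Were `p = q`, the form would be Hermitian
and only `a.re` would enter; the asymmetry `q - p` costs a term in `‖a‖`. -/
lemma re_mul_add_le (a y z : ℂ) {p q κ : ℝ} (hp : 0 ≤ p) (ha : 0 ≤ a.re) (hκ : |q - p| ≤ κ) :
    (a * (p * z * conj y)).re + (a * (q * y * conj z)).re
      ≤ (a.re * p + ‖a‖ * κ / 2) * (‖y‖ ^ 2 + ‖z‖ ^ 2) := by
  have e : (a * (p * z * conj y)).re + (a * (q * y * conj z)).re
      = a.re * p * (2 * (y * conj z).re) + (a * ((q - p : ℝ) * (y * conj z))).re := by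
    simp only [Complex.mul_re, Complex.mul_im, Complex.conj_re, Complex.conj_im, Complex.ofReal_re,
      Complex.ofReal_im]
    ring
  have hyz : ‖y * conj z‖ = ‖y‖ * ‖z‖ := by rw [norm_mul, RCLike.norm_conj]
  have hs : 2 * (‖y‖ * ‖z‖) ≤ ‖y‖ ^ 2 + ‖z‖ ^ 2 := by nlinarith [sq_nonneg (‖y‖ - ‖z‖)]
  have h1 : 2 * (y * conj z).re ≤ ‖y‖ ^ 2 + ‖z‖ ^ 2 := by
    have := Complex.re_le_norm (y * conj z)
    rw [hyz] at this
    linarith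
  have h2 : (a * ((q - p : ℝ) * (y * conj z))).re ≤ ‖a‖ * (κ * (‖y‖ * ‖z‖)) := by
    refine (Complex.re_le_norm _).trans ?_
    rw [norm_mul, norm_mul, hyz, Complex.norm_real, Real.norm_eq_abs]
    gcongr
  have hκ0 : 0 ≤ κ := (abs_nonneg _).trans hκ
  have h3 : ‖a‖ * (κ * (‖y‖ * ‖z‖)) ≤ ‖a‖ * κ / 2 * (‖y‖ ^ 2 + ‖z‖ ^ 2) := by
    have := mul_le_mul_of_nonneg_left hs (by positivity : 0 ≤ ‖a‖ * κ / 2)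
    linarith
  have h4 := mul_le_mul_of_nonneg_left h1 (mul_nonneg ha hp)
  rw [e]
  linarith

/-- The subtracted term on the left is the flux out of level `N`. The diagonal `-2n` absorbs the
neighbour interactions, which are of order `n` each, and regularity of `w` leaves only a bounded
remainder. The negative term on the right makes the induction work: it pays exactly for the `x N`
half of the next interaction. -/
lemma re_sum_diffusion_le {a : ℂ} (ha : 0 ≤ a.re) {w : ℕ → ℝ} {K : ℝ} (hw : IsRegularWeight w K)
    (x : ℕ → ℂ) (N : ℕ) :
    (∑ n ∈ Finset.range (N + 1), (a * (w n * diffusion x n * conj (x n))).re)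
        - (a * (((N + 1) * w N : ℝ) * x (N + 1) * conj (x N))).re
      ≤ (a.re * K + a.re + 2 * ‖a‖ * K) * ∑ n ∈ Finset.range (N + 1), w n * ‖x n‖ ^ 2
        - (a.re * (N + 1) + ‖a‖ * K) * (w N * ‖x N‖ ^ 2) := by
  have hK := hw.const_nonneg
  induction N with
  | zero =>
    have h0 := hw.pos 0
    simp only [zero_add, Finset.range_one, Finset.sum_singleton, diffusion]
    have : a * ((w 0 : ℂ) * (((0 : ℕ) + 1) * x (0 + 1) - 2 * (0 : ℕ) * x 0
        + ((0 - 1 : ℕ) : ℂ) * x (0 - 1)) * conj (x 0))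
        = a * ((((0 : ℕ) + 1) * w 0 : ℝ) * x (0 + 1) * conj (x 0)) := by
      push_cast; simp
    simp only [zero_add] at this
    rw [this, sub_self]
    have : 0 ≤ w 0 * ‖x 0‖ ^ 2 := by positivity
    have : 0 ≤ (a.re * K + ‖a‖ * K) * (w 0 * ‖x 0‖ ^ 2) := by positivity
    push_cast
    linarith
  | succ N ih =>
    rw [Finset.sum_range_succ, Finset.sum_range_succ _ (N + 1)]
    have hN := hw.pos N
    have hN1 := hw.pos (N + 1)
    have e : (a * (w (N + 1) * diffusion x (N + 1) * conj (x (N + 1)))).re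
        = (a * ((((N + 1 : ℕ) + 1) * w (N + 1) : ℝ) * x (N + 1 + 1) * conj (x (N + 1)))).re
          - 2 * a.re * (N + 1) * (w (N + 1) * ‖x (N + 1)‖ ^ 2)
          + (a * ((N * w (N + 1) : ℝ) * x N * conj (x (N + 1)))).re := by
      have h : a * (w (N + 1) * diffusion x (N + 1) * conj (x (N + 1)))
          = a * ((((N + 1 : ℕ) + 1) * w (N + 1) : ℝ) * x (N + 1 + 1) * conj (x (N + 1)))
          - ((2 * (N + 1) * (w (N + 1) * ‖x (N + 1)‖ ^ 2) : ℝ) : ℂ) * a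
          + a * ((N * w (N + 1) : ℝ) * x N * conj (x (N + 1))) := by
        have h2 : ((‖x (N + 1)‖ : ℂ)) ^ 2 = x (N + 1) * conj (x (N + 1)) := (Complex.mul_conj' _).symm
        simp only [diffusion, Nat.add_sub_cancel]
        push_cast
        rw [h2]
        ring
      rw [h, Complex.add_re, Complex.sub_re, Complex.re_ofReal_mul]
      ring
    have hflux := re_mul_add_le a (x N) (x (N + 1)) (p := (N + 1) * w N) (q := N * w (N + 1))
      (κ := |N * w (N + 1) - (N + 1) * w N|) (by positivity) ha le_rfl
    have h1 : ‖a‖ * |N * w (N + 1) - (N + 1) * w N| / 2 * ‖x N‖ ^ 2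
        ≤ ‖a‖ * K * (w N * ‖x N‖ ^ 2) := by
      have h := hw.flux_le N
      have h' := abs_nonneg (N * w (N + 1) - (N + 1) * w N)
      calc _ ≤ ‖a‖ * (K * w N) * ‖x N‖ ^ 2 := by
            gcongr
            have := mul_le_mul_of_nonneg_left h (norm_nonneg a)
            have := mul_nonneg (norm_nonneg a) h'
            linarith
        _ = _ := by ring
    have h2 : ‖a‖ * |N * w (N + 1) - (N + 1) * w N| / 2 * ‖x (N + 1)‖ ^ 2
        ≤ ‖a‖ * K * (w (N + 1) * ‖x (N + 1)‖ ^ 2) := by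
      have h := hw.flux_le_succ N
      have h' := abs_nonneg (N * w (N + 1) - (N + 1) * w N)
      calc _ ≤ ‖a‖ * (K * w (N + 1)) * ‖x (N + 1)‖ ^ 2 := by
            gcongr
            have := mul_le_mul_of_nonneg_left h (norm_nonneg a)
            have := mul_nonneg (norm_nonneg a) h'
            linarith
        _ = _ := by ring
    have h3 : a.re * ((N + 1) * w N) * ‖x (N + 1)‖ ^ 2
        ≤ a.re * (N + 1) * (w (N + 1) * ‖x (N + 1)‖ ^ 2)
          + a.re * K * (w (N + 1) * ‖x (N + 1)‖ ^ 2) := by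
      have h := hw.sub_le_succ N
      have h' := neg_abs_le (w (N + 1) - w N)
      have h'' : (N + 1) * w N ≤ (N + 1) * w (N + 1) + K * w (N + 1) := by
        have : ((N : ℝ) + 1) * -|w (N + 1) - w N| ≤ (N + 1) * (w (N + 1) - w N) := by gcongr
        linarith
      calc _ ≤ a.re * ((N + 1) * w (N + 1) + K * w (N + 1)) * ‖x (N + 1)‖ ^ 2 := by gcongr
        _ = _ := by ring
    rw [e]
    push_cast at ih hflux ⊢
    linarith

/-- The energy estimate: the flow of `a/2 (1 - z)² d/dz`, `0 ≤ Re a`, is bounded in weighted `ℓ²`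
norms, up to the flux through the truncation level. -/
lemma sum_norm_sq_flow_le {a : ℂ} (ha : 0 ≤ a.re) {w : ℕ → ℝ} {K : ℝ} (hw : IsRegularWeight w K)
    {A : ℕ → ℝ → ℂ}
    (hA : ∀ n, ∀ s ∈ Set.Icc (0 : ℝ) 1,
      HasDerivAt (A n) (a / 2 * diffusion (fun m => A m s) n) s)
    {N : ℕ} {ε : ℝ} (hε0 : 0 ≤ ε)
    (hε : ∀ s ∈ Set.Icc (0 : ℝ) 1, ‖a‖ * ((N + 1) * w N) * (‖A (N + 1) s‖ * ‖A N s‖) ≤ ε) :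
    ∑ n ∈ Finset.range (N + 1), w n * ‖A n 1‖ ^ 2
      ≤ Real.exp (a.re * K + a.re + 2 * ‖a‖ * K)
        * (∑ n ∈ Finset.range (N + 1), w n * ‖A n 0‖ ^ 2 + ε) := by
  set C := a.re * K + a.re + 2 * ‖a‖ * K with hC
  have hK := hw.const_nonneg
  have hC0 : 0 ≤ C := by positivity
  set e : ℝ → ℝ := fun s => ∑ n ∈ Finset.range (N + 1), w n * ‖A n s‖ ^ 2 with he
  have hde : ∀ s ∈ Set.Icc (0 : ℝ) 1, HasDerivAt e
      (∑ n ∈ Finset.range (N + 1), (a * (w n * diffusion (fun m => A m s) n * conj (A n s))).re) s := by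
    intro s hs
    refine HasDerivAt.fun_sum fun n _ => ?_
    refine (((hA n s hs).norm_sq).const_mul (w n)).congr_deriv ?_
    have : a * (w n * diffusion (fun m => A m s) n * conj (A n s))
        = ((2 * w n : ℝ) : ℂ) * ((a / 2 * diffusion (fun m => A m s) n) * conj (A n s)) := by
      push_cast; ring
    rw [this, Complex.re_ofReal_mul, Complex.inner]
    ring
  have hbound : ∀ s ∈ Set.Icc (0 : ℝ) 1,
      (∑ n ∈ Finset.range (N + 1), (a * (w n * diffusion (fun m => A m s) n * conj (A n s))).re)
        ≤ C * e s + ε := by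
    intro s hs
    have h1 := re_sum_diffusion_le ha hw (fun m => A m s) N
    have h2 : (a * (((N + 1) * w N : ℝ) * A (N + 1) s * conj (A N s))).re ≤ ε := by
      refine (Complex.re_le_norm _).trans (le_trans (le_of_eq ?_) (hε s hs))
      have := hw.pos N
      rw [norm_mul, norm_mul, norm_mul, RCLike.norm_conj, Complex.norm_real,
        Real.norm_of_nonneg (by positivity)]
      ring
    have h3 : 0 ≤ (a.re * (N + 1) + ‖a‖ * K) * (w N * ‖A N s‖ ^ 2) := by
      have := hw.pos N
      positivity
    simp only [he, hC]
    linarith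
  -- Grönwall: `e' ≤ C e + ε`, with `exp (-C s) ≤ 1` used to bound the `ε` term.
  have hanti : AntitoneOn (fun s => Real.exp (-C * s) * e s - ε * s) (Set.Icc 0 1) := by
    have hd : ∀ s ∈ Set.Icc (0 : ℝ) 1, HasDerivAt (fun s => Real.exp (-C * s) * e s - ε * s)
        (Real.exp (-C * s) * (-C * 1) * e s + Real.exp (-C * s) *
          (∑ n ∈ Finset.range (N + 1), (a * (w n * diffusion (fun m => A m s) n
            * conj (A n s))).re) - ε * 1) s := fun s hs =>
      ((((hasDerivAt_id s).const_mul (-C)).exp).mul (hde s hs)).sub ((hasDerivAt_id s).const_mul ε)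
    refine antitoneOn_of_hasDerivWithinAt_nonpos (convex_Icc _ _)
      (fun s hs => (hd s hs).continuousAt.continuousWithinAt)
      (fun s hs => (hd s (interior_subset hs)).hasDerivWithinAt) fun s hs => ?_
    have hs' := interior_subset hs
    have h1 := mul_le_mul_of_nonneg_left (hbound s hs') (Real.exp_pos (-C * s)).le
    have h2 : Real.exp (-C * s) ≤ 1 := Real.exp_le_one_iff.2 (by nlinarith [hs'.1])
    have h3 := mul_le_mul_of_nonneg_right h2 hε0
    linarith
  have h01 := hanti (Set.left_mem_Icc.2 zero_le_one) (Set.right_mem_Icc.2 zero_le_one) zero_le_one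
  simp only [mul_one, mul_zero, Real.exp_zero, one_mul, sub_zero] at h01
  have h5 : Real.exp C * Real.exp (-C) = 1 := by rw [← Real.exp_add]; simp
  have h6 := mul_le_mul_of_nonneg_left h01 (Real.exp_pos C).le
  have h7 : Real.exp C * (Real.exp (-C) * e 1 - ε) = e 1 - Real.exp C * ε := by
    linear_combination e 1 * h5
  rw [h7] at h6
  simp only [he] at h6
  linarith

/-! ### Power series of the parabolic semigroup and its flow equation. -/

/-- The Taylor series at the origin of `z ↦ (b + (1 - 2b) z) / (1 - b z)`. -/
noncomputable def parabolicSeries (b : ℂ) : PowerSeries ℂ :=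
  PowerSeries.mk fun n => match n with
    | 0 => b
    | n + 1 => (1 - b) ^ 2 * b ^ n

lemma coeff_zero_parabolicSeries (b : ℂ) : PowerSeries.coeff 0 (parabolicSeries b) = b := by
  rw [parabolicSeries, PowerSeries.coeff_mk]

lemma coeff_succ_parabolicSeries (b : ℂ) (n : ℕ) :
    PowerSeries.coeff (n + 1) (parabolicSeries b) = (1 - b) ^ 2 * b ^ n := by
  rw [parabolicSeries, PowerSeries.coeff_mk]

lemma parabolicSeries_zero : parabolicSeries 0 = PowerSeries.X := by
  ext n
  match n with
  | 0 => simp [coeff_zero_parabolicSeries]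
  | 1 => simp [coeff_succ_parabolicSeries 0 0]
  | n + 2 => rw [coeff_succ_parabolicSeries, PowerSeries.coeff_X]; simp

/-- The derivation `a/2 (1 - z)² d/dz` of the ring of power series. -/
noncomputable def flowDerivation (a : ℂ) (F : PowerSeries ℂ) : PowerSeries ℂ :=
  PowerSeries.C (a / 2) * (1 - PowerSeries.X) ^ 2 * PowerSeries.derivative ℂ F

lemma coeff_flowDerivation (a : ℂ) (F : PowerSeries ℂ) (n : ℕ) :
    PowerSeries.coeff n (flowDerivation a F)
      = a / 2 * diffusion (fun m => PowerSeries.coeff m F) n := by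
  have e : flowDerivation a F = PowerSeries.C (a / 2) *
      (PowerSeries.derivative ℂ F - PowerSeries.C 2 * (PowerSeries.X * PowerSeries.derivative ℂ F)
        + PowerSeries.X * (PowerSeries.X * PowerSeries.derivative ℂ F)) := by
    have : (PowerSeries.C (2 : ℂ)) = 2 := map_ofNat _ 2
    rw [flowDerivation, this]; ring
  rw [e, PowerSeries.coeff_C_mul, map_add, map_sub, PowerSeries.coeff_C_mul, diffusion]
  congr 1
  match n with
  | 0 => simp [PowerSeries.coeff_derivative]
  | 1 =>
    rw [PowerSeries.coeff_succ_X_mul, PowerSeries.coeff_succ_X_mul,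
      PowerSeries.coeff_zero_X_mul]
    simp [PowerSeries.coeff_derivative]; ring
  | n + 2 =>
    rw [PowerSeries.coeff_succ_X_mul, PowerSeries.coeff_succ_X_mul, PowerSeries.coeff_succ_X_mul]
    simp only [PowerSeries.coeff_derivative, show n + 2 - 1 = n + 1 from rfl]
    push_cast
    ring

lemma flowDerivation_mul (a : ℂ) (F G : PowerSeries ℂ) :
    flowDerivation a (F * G) = flowDerivation a F * G + F * flowDerivation a G := by
  simp only [flowDerivation, Derivation.leibniz, smul_eq_mul]
  ring

lemma hasDerivAt_coeff_mul {F G : ℝ → PowerSeries ℂ} {F' G' : PowerSeries ℂ} {s : ℝ}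
    (hF : ∀ n, HasDerivAt (fun s => PowerSeries.coeff n (F s)) (PowerSeries.coeff n F') s)
    (hG : ∀ n, HasDerivAt (fun s => PowerSeries.coeff n (G s)) (PowerSeries.coeff n G') s) (n : ℕ) :
    HasDerivAt (fun s => PowerSeries.coeff n (F s * G s))
      (PowerSeries.coeff n (F' * G s + F s * G')) s := by
  simp only [map_add, PowerSeries.coeff_mul, ← Finset.sum_add_distrib]
  exact HasDerivAt.fun_sum fun p _ => (hF p.1).mul (hG p.2)

/-- The parameter of the parabolic map acting as translation by `s a` in the half-plane. -/
noncomputable def flowParam (a : ℂ) (s : ℝ) : ℂ := s * a / (2 + s * a)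

lemma two_add_mul_ne_zero {a : ℂ} (ha : 0 < a.re) {s : ℝ} (hs : 0 ≤ s) : 2 + (s : ℂ) * a ≠ 0 := by
  intro h
  have := congrArg Complex.re h
  simp at this
  nlinarith

lemma one_sub_flowParam {a : ℂ} (ha : 0 < a.re) {s : ℝ} (hs : 0 ≤ s) :
    1 - flowParam a s = 2 / (2 + s * a) := by
  have := two_add_mul_ne_zero ha hs
  rw [flowParam]; field_simp; ring

lemma hasDerivAt_flowParam {a : ℂ} (ha : 0 < a.re) {s : ℝ} (hs : 0 ≤ s) :
    HasDerivAt (flowParam a) (a / 2 * (1 - flowParam a s) ^ 2) s := by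
  have hne := two_add_mul_ne_zero ha hs
  have h1 : HasDerivAt (fun s : ℝ => (s : ℂ) * a) (1 * a) s :=
    (Complex.ofRealCLM.hasDerivAt (x := s)).mul_const a
  refine (h1.div (h1.const_add 2) hne).congr_deriv ?_
  rw [one_sub_flowParam ha hs]
  field_simp
  ring

/-- The flow equation, read off coefficientwise from `b' = a/2 (1 - b)²`. -/
lemma hasDerivAt_coeff_parabolicSeries {a : ℂ} (ha : 0 < a.re) {s : ℝ} (hs : 0 ≤ s) (n : ℕ) :
    HasDerivAt (fun s => PowerSeries.coeff n (parabolicSeries (flowParam a s)))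
      (PowerSeries.coeff n (flowDerivation a (parabolicSeries (flowParam a s)))) s := by
  have hb := hasDerivAt_flowParam ha hs
  rw [coeff_flowDerivation, diffusion]
  match n with
  | 0 =>
    simp only [coeff_zero_parabolicSeries]
    refine hb.congr_deriv ?_
    simp [coeff_succ_parabolicSeries _ 0]
  | 1 =>
    simp only [coeff_succ_parabolicSeries]
    refine (((hb.const_sub 1).pow 2).mul (hb.pow 0)).congr_deriv ?_
    simp [coeff_zero_parabolicSeries]
    ring
  | n + 2 =>
    simp only [coeff_succ_parabolicSeries]
    refine (((hb.const_sub 1).pow 2).mul (hb.pow (n + 1))).congr_deriv ?_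
    simp only [show n + 2 - 1 = n + 1 from rfl, coeff_succ_parabolicSeries, Pi.pow_apply]
    push_cast
    ring

/-- Both the derivative in `s` and `flowDerivation a` satisfy the Leibniz rule, so the flow equation
passes to powers, and then by linearity to polynomials. -/
lemma hasDerivAt_coeff_parabolicSeries_pow {a : ℂ} (ha : 0 < a.re) {s : ℝ} (hs : 0 ≤ s)
    (k n : ℕ) :
    HasDerivAt (fun s => PowerSeries.coeff n (parabolicSeries (flowParam a s) ^ k))
      (PowerSeries.coeff n (flowDerivation a (parabolicSeries (flowParam a s) ^ k))) s := by
  induction k generalizing n with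
  | zero =>
    simp only [pow_zero, flowDerivation, PowerSeries.derivative_one, mul_zero, map_zero]
    exact hasDerivAt_const _ _
  | succ k ih =>
    simp only [pow_succ, flowDerivation_mul]
    exact hasDerivAt_coeff_mul ih (hasDerivAt_coeff_parabolicSeries ha hs) n

/-- Each Cauchy product has `n + 1` terms, which costs one more factor `n + 1` and leaves the
geometric rate unchanged. -/
lemma norm_coeff_pow_le {F : PowerSeries ℂ} {M ρ : ℝ} (hρ : 0 ≤ ρ)
    (hF : ∀ n, ‖PowerSeries.coeff n F‖ ≤ M * ρ ^ n) (k n : ℕ) :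
    ‖PowerSeries.coeff n (F ^ k)‖ ≤ M ^ k * (n + 1) ^ k * ρ ^ n := by
  have hM : 0 ≤ M := by simpa using (norm_nonneg _).trans (hF 0)
  induction k generalizing n with
  | zero =>
    rw [pow_zero, PowerSeries.coeff_one]
    split_ifs with h
    · simp [h]
    · simp only [norm_zero]; positivity
  | succ k ih =>
    rw [pow_succ, PowerSeries.coeff_mul]
    calc _ ≤ ∑ p ∈ Finset.HasAntidiagonal.antidiagonal n, M ^ (k + 1) * (n + 1) ^ k * ρ ^ n := by
          refine norm_sum_le_of_le _ fun p hp => ?_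
          have hpn := Finset.HasAntidiagonal.mem_antidiagonal.1 hp
          rw [norm_mul]
          calc _ ≤ (M ^ k * (p.1 + 1) ^ k * ρ ^ p.1) * (M * ρ ^ p.2) :=
                mul_le_mul (ih _) (hF _) (norm_nonneg _) (by positivity)
            _ ≤ (M ^ k * (n + 1) ^ k * ρ ^ p.1) * (M * ρ ^ p.2) := by
                have : (p.1 : ℝ) ≤ n := by exact_mod_cast (by omega : p.1 ≤ n)
                gcongr
            _ = _ := by rw [← hpn, pow_add]; ring
      _ = _ := by
          rw [Finset.sum_const, Finset.Nat.card_antidiagonal]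
          simp only [nsmul_eq_mul]
          push_cast
          ring

lemma hasSum_coeff_pow {F : PowerSeries ℂ} {z v : ℂ}
    (hn : Summable fun n => ‖PowerSeries.coeff n F * z ^ n‖)
    (hF : HasSum (fun n => PowerSeries.coeff n F * z ^ n) v) (k : ℕ) :
    (Summable fun n => ‖PowerSeries.coeff n (F ^ k) * z ^ n‖) ∧
      HasSum (fun n => PowerSeries.coeff n (F ^ k) * z ^ n) (v ^ k) := by
  induction k with
  | zero =>
    have h : ∀ n ≠ 0, PowerSeries.coeff n (F ^ 0) * z ^ n = 0 := fun n hn => by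
      rw [pow_zero, PowerSeries.coeff_one, if_neg hn, zero_mul]
    refine ⟨(hasSum_single 0 fun n hn => by rw [h n hn, norm_zero]).summable, ?_⟩
    simpa using hasSum_single 0 h
  | succ k ih =>
    have e : (fun n => PowerSeries.coeff n (F ^ (k + 1)) * z ^ n) = fun n =>
        ∑ p ∈ Finset.HasAntidiagonal.antidiagonal n, (PowerSeries.coeff p.1 (F ^ k) * z ^ p.1)
          * (PowerSeries.coeff p.2 F * z ^ p.2) := by
      funext n
      rw [pow_succ, PowerSeries.coeff_mul, Finset.sum_mul]
      refine Finset.sum_congr rfl fun p hp => ?_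
      rw [← Finset.HasAntidiagonal.mem_antidiagonal.1 hp, pow_add]; ring
    have hs := summable_norm_sum_mul_antidiagonal_of_summable_norm ih.1 hn
    refine ⟨by simpa only [funext_iff.1 e] using hs, ?_⟩
    rw [e, pow_succ, ← ih.2.tsum_eq, ← hF.tsum_eq,
      tsum_mul_tsum_eq_tsum_sum_antidiagonal_of_summable_norm ih.1 hn]
    exact hs.of_norm.hasSum

lemma hasSum_parabolicSeries {b z : ℂ} (hb : ‖b‖ < 1) (hz : ‖z‖ < 1) :
    (Summable fun n => ‖PowerSeries.coeff n (parabolicSeries b) * z ^ n‖) ∧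
      HasSum (fun n => PowerSeries.coeff n (parabolicSeries b) * z ^ n)
        ((b + (1 - 2 * b) * z) / (1 - b * z)) := by
  have hbz : ‖b * z‖ < 1 := by
    rw [norm_mul]
    nlinarith [norm_nonneg b, norm_nonneg z]
  have e : ∀ n, PowerSeries.coeff (n + 1) (parabolicSeries b) * z ^ (n + 1)
      = (1 - b) ^ 2 * z * (b * z) ^ n := fun n => by
    rw [coeff_succ_parabolicSeries, mul_pow]; ring
  constructor
  · rw [← summable_nat_add_iff 1]
    simp only [e, norm_mul, norm_pow]
    have := (summable_geometric_of_lt_one (norm_nonneg _) hbz).mul_left (‖1 - b‖ ^ 2 * ‖z‖)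
    simpa using this
  · rw [← hasSum_nat_add_iff' 1]
    simp only [e, Finset.range_one, Finset.sum_singleton, pow_zero, mul_one,
      coeff_zero_parabolicSeries]
    have hne : 1 - b * z ≠ 0 := fun h => by
      rw [← sub_eq_zero.1 h] at hbz
      simp at hbz
    have e2 : (b + (1 - 2 * b) * z) / (1 - b * z) - b = (1 - b) ^ 2 * z * (1 - b * z)⁻¹ := by
      field_simp
      ring
    rw [e2]
    exact (hasSum_geometric_of_norm_lt_one hbz).mul_left ((1 - b) ^ 2 * z)

/-- The numerator `s a` is smaller than `2 + s a` in norm, as `0 ≤ s a.re`; compactness makes this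
uniform. Hence the poles `1 / b` stay uniformly outside the closed disk. -/
lemma norm_flowParam_le {a : ℂ} (ha : 0 < a.re) :
    ∃ ρ : ℝ, 0 < ρ ∧ ρ < 1 ∧ ∀ s ∈ Set.Icc (0 : ℝ) 1, ‖flowParam a s‖ ≤ ρ := by
  have hlt : ∀ s ∈ Set.Icc (0 : ℝ) 1, ‖flowParam a s‖ < 1 := fun s hs => by
    rw [flowParam, norm_div, div_lt_one (norm_pos_iff.2 (two_add_mul_ne_zero ha hs.1)),
      ← sq_lt_sq₀ (norm_nonneg _) (norm_nonneg _), Complex.sq_norm, Complex.sq_norm,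
      Complex.normSq_apply, Complex.normSq_apply]
    simp
    nlinarith [hs.1, mul_nonneg hs.1 ha.le]
  have hcont : ContinuousOn (fun s => ‖flowParam a s‖) (Set.Icc 0 1) := fun s hs =>
    (hasDerivAt_flowParam ha hs.1).continuousAt.norm.continuousWithinAt
  obtain ⟨t, ht, hmax⟩ := isCompact_Icc.exists_isMaxOn ⟨0, by simp⟩ hcont
  have h1 := hlt t ht
  have h2 := norm_nonneg (flowParam a t)
  refine ⟨(‖flowParam a t‖ + 1) / 2, by linarith, by linarith, fun s hs => ?_⟩
  have := hmax hs
  simp only [Set.mem_ofPred_eq] at this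
  linarith

lemma norm_coeff_parabolicSeries_le {b : ℂ} {ρ : ℝ} (hρ : 0 < ρ) (hρ1 : ρ < 1) (hb : ‖b‖ ≤ ρ)
    (n : ℕ) : ‖PowerSeries.coeff n (parabolicSeries b)‖ ≤ 4 / ρ * ρ ^ n := by
  match n with
  | 0 =>
    rw [coeff_zero_parabolicSeries, pow_zero, mul_one]
    refine hb.trans (hρ1.le.trans ?_)
    rw [le_div_iff₀ hρ]
    linarith
  | n + 1 =>
    have h2 : ‖1 - b‖ ≤ 2 := by
      have := norm_sub_le 1 b
      rw [norm_one] at this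
      linarith
    rw [coeff_succ_parabolicSeries, norm_mul, norm_pow, norm_pow]
    calc ‖1 - b‖ ^ 2 * ‖b‖ ^ n ≤ 2 ^ 2 * ρ ^ n := by gcongr
      _ = 4 / ρ * (ρ ^ n * ρ) := by field_simp; norm_num
      _ = _ := by rw [pow_succ]

/-! ### Boundedness on polynomials. -/

namespace Dirichlet

lemma exists_weight_le (ν : ℝ) : ∃ q : ℕ, ∀ n : ℕ, weight ν n ≤ ((n : ℝ) + 1) ^ q := by
  obtain ⟨q, hq⟩ := exists_nat_ge ν
  refine ⟨q, fun n => ?_⟩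
  rw [← Real.rpow_natCast]
  exact Real.rpow_le_rpow_of_exponent_le (by linarith [n.cast_nonneg (α := ℝ)]) hq

lemma exists_weight_sq_le (ν : ℝ) : ∃ q : ℕ, ∀ n : ℕ, weight ν n ^ 2 ≤ ((n : ℝ) + 1) ^ q := by
  obtain ⟨q, hq⟩ := exists_weight_le ν
  refine ⟨q * 2, fun n => ?_⟩
  rw [pow_mul]
  exact pow_le_pow_left₀ (weight_pos ν n).le (hq n) 2

lemma exists_weight_inv_le (ν : ℝ) : ∃ q : ℕ, ∀ n : ℕ, (weight ν n)⁻¹ ≤ ((n : ℝ) + 1) ^ q := by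
  obtain ⟨q, hq⟩ := exists_weight_le (-ν)
  refine ⟨q, fun n => le_trans (le_of_eq ?_) (hq n)⟩
  rw [weight, weight, Real.rpow_neg (by positivity)]

end Dirichlet

/-- Composition with a parabolic map is bounded on polynomials, in every weighted norm. -/
lemma exists_sum_parabolicSeries_le {a : ℂ} (ha : 0 < a.re) (ν : ℝ) :
    ∃ M : ℝ, 0 ≤ M ∧ ∀ (x : ℕ → ℂ) (J N : ℕ),
      ∑ n ∈ Finset.range N, Dirichlet.weight ν n ^ 2 *
        ‖∑ k ∈ Finset.range J, x k * PowerSeries.coeff n (parabolicSeries (flowParam a 1) ^ k)‖ ^ 2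
      ≤ M * ∑ k ∈ Finset.range J, Dirichlet.weight ν k ^ 2 * ‖x k‖ ^ 2 := by
  obtain ⟨K, hw⟩ := exists_isRegularWeight ν
  obtain ⟨ρ, hρ0, hρ1, hρ⟩ := norm_flowParam_le ha
  obtain ⟨q, hq⟩ := Dirichlet.exists_weight_sq_le ν
  refine ⟨Real.exp (a.re * K + a.re + 2 * ‖a‖ * K), (Real.exp_pos _).le, fun x J N => ?_⟩
  -- `A n s` is the `n`-th Taylor coefficient of the polynomial `∑ x k z ^ k` composed with the
  -- time-`s` map.
  set A : ℕ → ℝ → ℂ := fun n s =>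
    ∑ k ∈ Finset.range J, x k * PowerSeries.coeff n (parabolicSeries (flowParam a s) ^ k) with hA
  set X : ℝ := ∑ k ∈ Finset.range J, ‖x k‖ * (4 / ρ) ^ k with hX
  have hX0 : 0 ≤ X := Finset.sum_nonneg fun k _ => by positivity
  have hder : ∀ n, ∀ s ∈ Set.Icc (0 : ℝ) 1,
      HasDerivAt (A n) (a / 2 * diffusion (fun m => A m s) n) s := by
    intro n s hs
    refine (HasDerivAt.fun_sum fun k _ =>
      (hasDerivAt_coeff_parabolicSeries_pow ha hs.1 k n).const_mul (x k)).congr_deriv ?_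
    simp only [coeff_flowDerivation, diffusion, hA, Finset.mul_sum, ← Finset.sum_add_distrib,
      ← Finset.sum_sub_distrib]
    exact Finset.sum_congr rfl fun k _ => by ring
  have hdecay : ∀ n, ∀ s ∈ Set.Icc (0 : ℝ) 1, ‖A n s‖ ≤ X * (n + 1) ^ J * ρ ^ n := by
    intro n s hs
    rw [hX, Finset.sum_mul, Finset.sum_mul]
    refine norm_sum_le_of_le _ fun k hk => ?_
    rw [norm_mul, mul_assoc ‖x k‖, mul_assoc ‖x k‖]
    refine mul_le_mul_of_nonneg_left ?_ (norm_nonneg _)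
    refine (norm_coeff_pow_le hρ0.le
      (norm_coeff_parabolicSeries_le hρ0 hρ1 (hρ s hs)) k n).trans ?_
    have h1 : (1 : ℝ) ≤ n + 1 := by linarith [n.cast_nonneg (α := ℝ)]
    have := pow_le_pow_right₀ h1 (Finset.mem_range.1 hk).le
    gcongr
  -- A bound on the flux through level `n`, uniform in `s`: geometric decay beats the polynomial
  -- factors, so it vanishes in the limit.
  set ε : ℕ → ℝ := fun n => ‖a‖ * X ^ 2 * (((n + 2 : ℕ) : ℝ) ^ (1 + q + J + J) * ρ ^ n) with hε
  have hflux : ∀ n : ℕ, ∀ s ∈ Set.Icc (0 : ℝ) 1,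
      ‖a‖ * ((n + 1) * Dirichlet.weight ν n ^ 2) * (‖A (n + 1) s‖ * ‖A n s‖) ≤ ε n := by
    intro n s hs
    have h1 : ‖A (n + 1) s‖ ≤ X * ((n + 2 : ℕ) : ℝ) ^ J := by
      refine (hdecay (n + 1) s hs).trans ?_
      have := pow_le_one₀ hρ0.le hρ1.le (n := n + 1)
      have e : (((n + 1 : ℕ) : ℝ) + 1) = ((n + 2 : ℕ) : ℝ) := by push_cast; ring
      rw [e]
      exact mul_le_of_le_one_right (by positivity) this
    have hle : (n : ℝ) + 1 ≤ ((n + 2 : ℕ) : ℝ) := by push_cast; linarith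
    have h2 : ‖A n s‖ ≤ X * ((n + 2 : ℕ) : ℝ) ^ J * ρ ^ n := (hdecay n s hs).trans (by gcongr)
    have h3 : Dirichlet.weight ν n ^ 2 ≤ ((n + 2 : ℕ) : ℝ) ^ q := (hq n).trans (by gcongr)
    calc _ ≤ ‖a‖ * (((n + 2 : ℕ) : ℝ) * ((n + 2 : ℕ) : ℝ) ^ q)
          * ((X * ((n + 2 : ℕ) : ℝ) ^ J) * (X * ((n + 2 : ℕ) : ℝ) ^ J * ρ ^ n)) := by gcongr
      _ = ε n := by simp only [hε, pow_add, pow_one]; ring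
  have hlim : Filter.Tendsto ε Filter.atTop (nhds 0) := by
    have h := tendsto_pow_const_mul_const_pow_of_abs_lt_one (1 + q + J + J)
      (abs_of_pos hρ0 ▸ hρ1)
    have h2 := ((Filter.tendsto_add_atTop_iff_nat 2).2 h).const_mul (‖a‖ * X ^ 2 * (ρ ^ 2)⁻¹)
    rw [mul_zero] at h2
    refine h2.congr fun n => ?_
    simp only [hε, pow_add ρ n 2]
    field_simp
  have hA0 : ∀ n, A n 0 = if n ∈ Finset.range J then x n else 0 := by
    intro n
    have h0 : flowParam a 0 = 0 := by simp [flowParam]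
    simp only [hA, h0, parabolicSeries_zero, PowerSeries.coeff_X_pow, mul_ite, mul_one, mul_zero]
    rw [Finset.sum_ite_eq]
  have hsum0 : ∀ n, ∑ m ∈ Finset.range n, Dirichlet.weight ν m ^ 2 * ‖A m 0‖ ^ 2
      ≤ ∑ k ∈ Finset.range J, Dirichlet.weight ν k ^ 2 * ‖x k‖ ^ 2 := by
    intro n
    have e : ∀ m, Dirichlet.weight ν m ^ 2 * ‖A m 0‖ ^ 2
        = if m ∈ Finset.range J then Dirichlet.weight ν m ^ 2 * ‖x m‖ ^ 2 else 0 := fun m => by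
      rw [hA0]; split_ifs <;> simp
    simp only [e]
    rw [← Finset.sum_filter]
    refine Finset.sum_le_sum_of_subset_of_nonneg (fun m hm => (Finset.mem_filter.1 hm).2)
      fun m _ _ => by positivity
  have hfin : ∀ᶠ n in Filter.atTop,
      ∑ m ∈ Finset.range N, Dirichlet.weight ν m ^ 2 * ‖A m 1‖ ^ 2
      ≤ Real.exp (a.re * K + a.re + 2 * ‖a‖ * K)
        * (∑ k ∈ Finset.range J, Dirichlet.weight ν k ^ 2 * ‖x k‖ ^ 2 + ε n) := by
    filter_upwards [Filter.eventually_ge_atTop N] with n hn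
    have h1 := sum_norm_sq_flow_le ha.le hw hder (N := n) (ε := ε n)
      (by simp only [hε]; positivity) (hflux n)
    refine le_trans (Finset.sum_le_sum_of_subset_of_nonneg
      (Finset.range_mono (by omega : N ≤ n + 1)) fun m _ _ => by positivity) (h1.trans ?_)
    exact mul_le_mul_of_nonneg_left (by linarith [hsum0 (n + 1)]) (Real.exp_pos _).le
  have hlim2 := (hlim.const_add
    (∑ k ∈ Finset.range J, Dirichlet.weight ν k ^ 2 * ‖x k‖ ^ 2)).const_mul
    (Real.exp (a.re * K + a.re + 2 * ‖a‖ * K))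
  rw [add_zero] at hlim2
  exact ge_of_tendsto hlim2 hfin

/-! ### Taylor coefficients of compositions and the composition operator. -/

namespace Dirichlet

/-- The extension by zero to `ℂ` of a function on the disk. -/
noncomputable def extend (f : 𝔻 → ℂ) (z : ℂ) : ℂ :=
  if h : ‖z‖ < 1 then f (Complex.UnitDisc.mk z h) else 0

lemma extend_of_lt (f : 𝔻 → ℂ) {z : ℂ} (h : ‖z‖ < 1) :
    extend f z = f (Complex.UnitDisc.mk z h) := dif_pos h

lemma extend_coe (f : 𝔻 → ℂ) (z : 𝔻) : extend f z = f z := by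
  rw [extend_of_lt f z.norm_lt_one, Complex.UnitDisc.mk_coe]

lemma HasTaylor.summable_norm {f : 𝔻 → ℂ} {x : ℕ → ℂ} (hx : HasTaylor f x) {r : ℝ} (h0 : 0 ≤ r)
    (h1 : r < 1) : Summable fun n => ‖x n‖ * r ^ n := by
  have hr : ‖(r : ℂ)‖ = r := by rw [Complex.norm_real, Real.norm_of_nonneg h0]
  have := (hx (Complex.UnitDisc.mk r (by rwa [hr]))).summable.norm
  simpa [abs_of_nonneg h0] using this

lemma HasTaylor.sub {f g : 𝔻 → ℂ} {x y : ℕ → ℂ} (hx : HasTaylor f x) (hy : HasTaylor g y) :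
    HasTaylor (fun z => f z - g z) (fun n => x n - y n) := fun z => by
  simpa [sub_mul] using (hx z).sub (hy z)

lemma HasTaylor.differentiableOn_extend {f : 𝔻 → ℂ} {x : ℕ → ℂ} (hx : HasTaylor f x) :
    DifferentiableOn ℂ (extend f) (Metric.ball 0 1) := by
  intro z hz
  have hz' : ‖z‖ < 1 := by simpa using hz
  obtain ⟨r, hzr, hr1⟩ := exists_between hz'
  have hr0 : 0 ≤ r := (norm_nonneg z).trans hzr.le
  have hd : DifferentiableOn ℂ (fun w => ∑' n, x n * w ^ n) (Metric.ball 0 r) := by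
    refine Complex.differentiableOn_tsum_of_summable_norm (hx.summable_norm hr0 hr1)
      (fun n => (by fun_prop : Differentiable ℂ fun w : ℂ => x n * w ^ n).differentiableOn)
      Metric.isOpen_ball fun n w hw => ?_
    rw [norm_mul, norm_pow]
    have : ‖w‖ ≤ r := by simpa using (Metric.mem_ball.1 hw).le
    gcongr
  have hzr' : Metric.ball (0 : ℂ) r ∈ nhds z := Metric.isOpen_ball.mem_nhds (by simpa using hzr)
  refine ((hd.differentiableAt hzr').congr_of_eventuallyEq ?_).differentiableWithinAt
  filter_upwards [hzr'] with w hw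
  have hw' : ‖w‖ < 1 := lt_trans (by simpa using hw) hr1
  rw [extend_of_lt f hw']
  exact (hx (Complex.UnitDisc.mk w hw')).tsum_eq.symm

lemma hasTaylor_of_differentiableOn {g : ℂ → ℂ} (hg : DifferentiableOn ℂ g (Metric.ball 0 1)) :
    HasTaylor (fun z => g z) fun n => (n.factorial : ℂ)⁻¹ * iteratedDeriv n g 0 := fun z => by
  have := Complex.hasSum_taylorSeries_on_ball hg (z := z) (by simpa using z.norm_lt_one)
  refine this.congr_fun fun n => ?_
  simp only [smul_eq_mul, sub_zero]
  ring

lemma HasTaylor.norm_coeff_le {f : 𝔻 → ℂ} {x : ℕ → ℂ} (hx : HasTaylor f x) {δ : ℝ}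
    (hδ : ∀ z : 𝔻, ‖(z : ℂ)‖ = 1 / 2 → ‖f z‖ ≤ δ) (n : ℕ) : ‖x n‖ ≤ δ * 2 ^ n := by
  have hd := hx.differentiableOn_extend
  have h1 : HasTaylor f fun n => (n.factorial : ℂ)⁻¹ * iteratedDeriv n (extend f) 0 := by
    have := hasTaylor_of_differentiableOn hd
    simpa only [extend_coe] using this
  have hd' : DiffContOnCl ℂ (extend f) (Metric.ball 0 (1 / 2)) :=
    (hd.mono (Metric.closure_ball_subset_closedBall.trans
      (Metric.closedBall_subset_ball (by norm_num)))).diffContOnCl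
  have h2 := Complex.norm_iteratedDeriv_le_of_forall_mem_sphere_norm_le n (by norm_num) hd'
    (C := δ) fun z hz => by
      have hz' : ‖z‖ = 1 / 2 := by simpa using hz
      rw [extend_of_lt f (by rw [hz']; norm_num)]
      exact hδ _ hz'
  rw [hx.unique h1, norm_mul, norm_inv, Complex.norm_natCast]
  have hn : (0 : ℝ) < n.factorial := by exact_mod_cast n.factorial_pos
  refine (mul_le_mul_of_nonneg_left h2 (by positivity)).trans (le_of_eq ?_)
  rw [one_div, inv_pow, div_inv_eq_mul]
  field_simp

end Dirichlet

/-- The disk map which is translation by `a` in the half-plane model with `η` at infinity. -/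
lemma eq_of_cayley_translation {φ : 𝔻 → 𝔻} {η a : ℂ} (hη : ‖η‖ = 1) (ha : 0 < a.re)
    (hφ : ∀ z : 𝔻, (η + φ z) / (η - φ z) = (η + z) / (η - z) + a) (z : 𝔻) :
    1 - flowParam a 1 * (z / η) ≠ 0 ∧
    (φ z : ℂ) = η * ((flowParam a 1 + (1 - 2 * flowParam a 1) * (z / η))
      / (1 - flowParam a 1 * (z / η))) := by
  have hη0 : η ≠ 0 := fun h => by simp [h] at hη
  have hne : ∀ z : 𝔻, η - z ≠ 0 := fun z h => by
    have := z.norm_lt_one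
    rw [← sub_eq_zero.1 h, hη] at this
    exact lt_irrefl _ this
  have h2 : 2 + a ≠ 0 := by simpa using two_add_mul_ne_zero ha zero_le_one
  have hb : flowParam a 1 = a / (2 + a) := by simp [flowParam]
  have h1 := hne z
  have h3 := hne (φ z)
  have hz := hφ z
  have hden : 2 * η + a * (η - z) ≠ 0 := by
    intro h
    have hre := re_cayley hη z.norm_lt_one
    have : (η + z) / (η - z) + a = -1 := by
      field_simp
      linear_combination h
    have hre2 := congrArg Complex.re this
    simp only [Complex.add_re, Complex.neg_re, Complex.one_re] at hre2
    linarith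
  have hden' : 1 - flowParam a 1 * (z / η) = (2 * η + a * (η - z)) / ((2 + a) * η) := by
    rw [hb]; field_simp; ring
  refine ⟨by rw [hden']; simp [hden, h2, hη0], ?_⟩
  have hnum : flowParam a 1 + (1 - 2 * flowParam a 1) * (z / η)
      = (2 * z + a * (η - z)) / ((2 + a) * η) := by
    rw [hb]; field_simp; ring
  rw [hden', hnum, div_div_div_cancel_right₀ (by simp [h2, hη0]), mul_div_assoc',
    eq_div_iff hden]
  field_simp at hz
  linear_combination hz

namespace Dirichlet

lemma norm_sq_eq {ν : ℝ} (f : Space ν) :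
    ‖f‖ ^ 2 = ∑' n, ‖coeff f n‖ ^ 2 * weight ν n ^ 2 := by
  have h : ∀ n, coeff f n * conj (coeff f n) * ((weight ν n ^ 2 : ℝ) : ℂ)
      = ((‖coeff f n‖ ^ 2 * weight ν n ^ 2 : ℝ) : ℂ) := fun n => by
    rw [Complex.mul_conj']; push_cast; ring
  have h2 : inner ℂ f f = ∑' n, coeff f n * conj (coeff f n) * ((weight ν n ^ 2 : ℝ) : ℂ) := rfl
  rw [@norm_sq_eq_re_inner ℂ, h2]
  simp only [h]
  rw [← Complex.ofReal_tsum]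
  simp

section Composition

variable {φ : 𝔻 → 𝔻} {η a : ℂ}

/-- The circle carries the Cauchy estimates for coefficients. Its image lies in a smaller disk,
where Taylor polynomials converge uniformly. -/
lemma exists_norm_le_of_norm_eq_half (hη : ‖η‖ = 1) (ha : 0 < a.re)
    (hφ : ∀ z : 𝔻, (η + φ z) / (η - φ z) = (η + z) / (η - z) + a) :
    ∃ q : ℝ, 0 ≤ q ∧ q < 1 ∧ ∀ z : 𝔻, ‖(z : ℂ)‖ = 1 / 2 → ‖(φ z : ℂ)‖ ≤ q := by
  set g : ℂ → ℂ := fun z => η * ((flowParam a 1 + (1 - 2 * flowParam a 1) * (z / η))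
      / (1 - flowParam a 1 * (z / η))) with hg
  have hcont : ContinuousOn (fun z => ‖g z‖) (Metric.sphere 0 (1 / 2)) := by
    refine (continuousOn_const.mul (ContinuousOn.div (by fun_prop) (by fun_prop)
      fun z hz => ?_)).norm
    have hz' : ‖z‖ = 1 / 2 := by simpa using hz
    exact (eq_of_cayley_translation hη ha hφ (.mk z (by rw [hz']; norm_num))).1
  obtain ⟨t, ht, hmax⟩ := (isCompact_sphere (0 : ℂ) (1 / 2)).exists_isMaxOn
    ⟨1 / 2, by simp⟩ hcont
  have ht' : ‖t‖ < 1 := by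
    have : ‖t‖ = 1 / 2 := by simpa using ht
    rw [this]; norm_num
  refine ⟨‖g t‖, norm_nonneg _, ?_, fun z hz => ?_⟩
  · have := (eq_of_cayley_translation hη ha hφ (.mk t ht')).2
    rw [Complex.UnitDisc.coe_mk] at this
    simp only [hg]
    rw [← this]
    exact (φ _).norm_lt_one
  · rw [(eq_of_cayley_translation hη ha hφ z).2]
    exact hmax (by simpa using hz)

lemma hasTaylor_pow (hη : ‖η‖ = 1) (ha : 0 < a.re)
    (hφ : ∀ z : 𝔻, (η + φ z) / (η - φ z) = (η + z) / (η - z) + a) (k : ℕ) :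
    HasTaylor (fun z => (φ z : ℂ) ^ k) fun n =>
      η ^ k * PowerSeries.coeff n (parabolicSeries (flowParam a 1) ^ k) * (η⁻¹) ^ n := by
  intro z
  have hz : ‖(z : ℂ) / η‖ < 1 := by rw [norm_div, hη, div_one]; exact z.norm_lt_one
  obtain ⟨ρ, -, hρ1, hρ⟩ := norm_flowParam_le ha
  have hb : ‖flowParam a 1‖ < 1 := (hρ 1 (by simp)).trans_lt hρ1
  have h := hasSum_parabolicSeries hb hz
  have h2 := (hasSum_coeff_pow h.1 h.2 k).2.mul_left (η ^ k)
  rw [← mul_pow, ← (eq_of_cayley_translation hη ha hφ z).2] at h2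
  refine h2.congr_fun fun n => ?_
  rw [div_eq_mul_inv, mul_pow]
  ring

lemma exists_hasTaylor_comp (hη : ‖η‖ = 1) (ha : 0 < a.re)
    (hφ : ∀ z : 𝔻, (η + φ z) / (η - φ z) = (η + z) / (η - z) + a) {f : 𝔻 → ℂ} {x : ℕ → ℂ}
    (hx : HasTaylor f x) : ∃ c, HasTaylor (fun z => f (φ z)) c := by
  set g : ℂ → ℂ := fun z => η * ((flowParam a 1 + (1 - 2 * flowParam a 1) * (z / η))
      / (1 - flowParam a 1 * (z / η))) with hg
  have hgφ : ∀ z : 𝔻, g z = φ z := fun z => (eq_of_cayley_translation hη ha hφ z).2.symm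
  have hd : DifferentiableOn ℂ g (Metric.ball 0 1) := by
    refine (DifferentiableOn.div (by fun_prop) (by fun_prop) fun z hz => ?_).const_mul η
    exact (eq_of_cayley_translation hη ha hφ (.mk z (by simpa using hz))).1
  have hmaps : Set.MapsTo g (Metric.ball 0 1) (Metric.ball 0 1) := fun z hz => by
    have := hgφ (.mk z (by simpa using hz))
    rw [Complex.UnitDisc.coe_mk] at this
    rw [this]
    simpa using (φ _).norm_lt_one
  have h := hasTaylor_of_differentiableOn (hx.differentiableOn_extend.comp hd hmaps)
  simp only [Function.comp_apply, hgφ, extend_coe] at h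
  exact ⟨_, h⟩

/-- The Taylor coefficients of a composition are the limits of those of the compositions of the
Taylor polynomials. -/
lemma tendsto_coeff_comp (hη : ‖η‖ = 1) (ha : 0 < a.re)
    (hφ : ∀ z : 𝔻, (η + φ z) / (η - φ z) = (η + z) / (η - z) + a) {f : 𝔻 → ℂ} {x c : ℕ → ℂ}
    (hx : HasTaylor f x) (hc : HasTaylor (fun z => f (φ z)) c) (n : ℕ) :
    Filter.Tendsto (fun J => ∑ k ∈ Finset.range J, x k * (η ^ k *
      PowerSeries.coeff n (parabolicSeries (flowParam a 1) ^ k) * (η⁻¹) ^ n))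
      Filter.atTop (nhds (c n)) := by
  obtain ⟨q, hq0, hq1, hq⟩ := exists_norm_le_of_norm_eq_half hη ha hφ
  have hs := hx.summable_norm hq0 hq1
  have hT : ∀ J, HasTaylor (fun z => ∑ k ∈ Finset.range J, x k * (φ z : ℂ) ^ k) fun n =>
      ∑ k ∈ Finset.range J, x k * (η ^ k *
        PowerSeries.coeff n (parabolicSeries (flowParam a 1) ^ k) * (η⁻¹) ^ n) := fun J z => by
    simp only [Finset.sum_mul, mul_assoc (x _)]
    exact hasSum_sum fun k _ => (hasTaylor_pow hη ha hφ k z).mul_left (x k)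
  have hlim := (tendsto_sum_nat_add fun k => ‖x k‖ * q ^ k).mul_const ((2 : ℝ) ^ n)
  rw [zero_mul] at hlim
  rw [tendsto_iff_norm_sub_tendsto_zero]
  refine squeeze_zero (fun _ => norm_nonneg _) (fun J => ?_) hlim
  rw [norm_sub_rev]
  -- On the circle the difference is a Taylor tail of `f` evaluated at `φ z`, dominated by the tail
  -- of `∑ ‖x k‖ q ^ k`.
  refine (hc.sub (hT J)).norm_coeff_le (fun z hz => ?_) n
  have h1 := (hasSum_nat_add_iff' J).2 (hx (φ z))
  rw [← h1.tsum_eq]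
  refine tsum_of_norm_bounded ((summable_nat_add_iff J).2 hs).hasSum fun k => ?_
  rw [norm_mul, norm_pow]
  gcongr
  exact hq z hz

/-- Boundedness of the composition operator. -/
lemma exists_norm_sq_comp_le (ν : ℝ) (hη : ‖η‖ = 1) (ha : 0 < a.re)
    (hφ : ∀ z : 𝔻, (η + φ z) / (η - φ z) = (η + z) / (η - z) + a) :
    ∃ M : ℝ, 0 ≤ M ∧ ∀ f : Space ν, ∃ g : Space ν, (∀ z, g z = f (φ z)) ∧
      ‖g‖ ^ 2 ≤ M * ‖f‖ ^ 2 := by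
  obtain ⟨M, hM0, hM⟩ := exists_sum_parabolicSeries_le ha ν
  refine ⟨M, hM0, fun f => ?_⟩
  have hx := hasTaylor_coeff f
  obtain ⟨c, hc⟩ := exists_hasTaylor_comp hη ha hφ hx
  have hbound : ∀ N, ∑ n ∈ Finset.range N, ‖c n‖ ^ 2 * weight ν n ^ 2 ≤ M * ‖f‖ ^ 2 := by
    intro N
    have hlim := tendsto_finsetSum (Finset.range N) fun n _ =>
      ((tendsto_coeff_comp hη ha hφ hx hc n).norm.pow 2).mul_const (weight ν n ^ 2)
    refine le_of_tendsto' hlim fun J => ?_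
    -- `φ` is the time-one map conjugated by the rotation by `η`; the unimodular factors `η ^ k` do
    -- not affect the norms.
    have h1 := hM (fun k => coeff f k * η ^ k) J N
    have h2 : ∑ k ∈ Finset.range J, weight ν k ^ 2 * ‖coeff f k * η ^ k‖ ^ 2 ≤ ‖f‖ ^ 2 := by
      rw [norm_sq_eq]
      refine le_trans (le_of_eq (Finset.sum_congr rfl fun k _ => ?_))
        ((summable_coeff f).sum_le_tsum (Finset.range J) fun k _ => by positivity)
      rw [norm_mul, norm_pow, hη, one_pow, mul_one, mul_comm]
    refine le_trans (le_of_eq (Finset.sum_congr rfl fun n _ => ?_))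
      (h1.trans (mul_le_mul_of_nonneg_left h2 hM0))
    have e : ∑ k ∈ Finset.range J, coeff f k * (η ^ k *
        PowerSeries.coeff n (parabolicSeries (flowParam a 1) ^ k) * (η⁻¹) ^ n)
        = (∑ k ∈ Finset.range J, coeff f k * η ^ k *
          PowerSeries.coeff n (parabolicSeries (flowParam a 1) ^ k)) * (η⁻¹) ^ n := by
      rw [Finset.sum_mul]
      exact Finset.sum_congr rfl fun k _ => by ring
    rw [e, norm_mul, norm_pow, norm_inv, hη, inv_one, one_pow, mul_one, mul_comm]
  have hs : Summable fun n => ‖c n‖ ^ 2 * weight ν n ^ 2 :=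
    summable_of_sum_range_le (fun n => by positivity) hbound
  obtain ⟨g, hg⟩ : ∃ g : Space ν, ∀ z, g z = f (φ z) := ⟨⟨fun z => f (φ z), c, hc, hs⟩, fun _ => rfl⟩
  have hgc : coeff g = c := (hasTaylor_coeff g).unique fun z => by
    rw [hg]
    exact hc z
  refine ⟨g, hg, ?_⟩
  rw [norm_sq_eq g, hgc]
  exact hs.tsum_le_of_sum_range_le hbound

lemma exists_compositionOperator (ν : ℝ) (hη : ‖η‖ = 1) (ha : 0 < a.re)
    (hφ : ∀ z : 𝔻, (η + φ z) / (η - φ z) = (η + z) / (η - z) + a) :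
    ∃ C : Space ν →L[ℂ] Space ν, ∀ (f : Space ν) (z : 𝔻), C f z = f (φ z) := by
  obtain ⟨M, hM0, hM⟩ := exists_norm_sq_comp_le ν hη ha hφ
  choose T hT hTn using hM
  let L : Space ν →ₗ[ℂ] Space ν :=
    { toFun := T
      map_add' := fun f g => Subtype.ext <| funext fun z => by
        rw [add_apply, hT, hT, hT, add_apply]
      map_smul' := fun r f => Subtype.ext <| funext fun z => by
        rw [smul_apply, hT, hT, smul_apply, RingHom.id_apply] }
  refine ⟨L.mkContinuous (Real.sqrt M) fun f => ?_, hT⟩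
  refine abs_le_of_sq_le_sq' ?_ (by positivity) |>.2
  rw [mul_pow, Real.sq_sqrt hM0]
  exact hTn f

end Composition

end Dirichlet

/-! ### A criterion against recurrence. -/

/-- An operator is not recurrent if the pullbacks of a nonzero functional along its powers tend to
zero in norm. -/
lemma not_isRecurrent_of_tendsto {X : Type*} [NormedAddCommGroup X] [NormedSpace ℂ X]
    {T : X →L[ℂ] X} {L : X → ℂ} {ε : ℕ → ℝ} (hε : Filter.Tendsto ε Filter.atTop (nhds 0))
    (hL : ∀ k f, ‖L ((T ^ k) f)‖ ≤ ε k * ‖f‖) (hsub : ∀ f g, L (f - g) = L f - L g)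
    {f₀ : X} (hf₀ : L f₀ ≠ 0) : ¬ IsRecurrent T := by
  intro hT
  have hpos : 0 < ‖L f₀‖ := norm_pos_iff.2 hf₀
  -- A periodic `f₀` would give `‖L f₀‖ ≤ ε (k * j) * ‖f₀‖` for all `j`, hence `L f₀ = 0`.
  have hper : ∀ k : ℕ, 1 ≤ k → (T ^ k) f₀ ≠ f₀ := by
    intro k hk hfix
    have hfix' : ∀ j : ℕ, (T ^ (k * j)) f₀ = f₀ := by
      intro j
      induction j with
      | zero => simp
      | succ j ih => rw [Nat.mul_succ, pow_add, mul_apply_eq_comp, hfix, ih]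
    have hlim : Filter.Tendsto (fun j : ℕ => ε (k * j) * ‖f₀‖) Filter.atTop (nhds 0) := by
      have := (hε.comp (Filter.tendsto_id.const_mul_atTop' hk)).mul_const ‖f₀‖
      rwa [zero_mul] at this
    have hle : ‖L f₀‖ ≤ 0 := ge_of_tendsto' hlim fun j => by
      have := hL (k * j) f₀
      rwa [hfix'] at this
    linarith
  have hsep : ∀ k : ℕ, 1 ≤ k → ∃ U ∈ nhds f₀, ∀ f ∈ U, (T ^ k) f ∉ U := by
    intro k hk
    obtain ⟨V, W, hV, hW, hfV, hfW, hdisj⟩ := t2_separation (hper k hk).symm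
    refine ⟨V ∩ (T ^ k) ⁻¹' W, Filter.inter_mem (hV.mem_nhds hfV)
      ((T ^ k).continuous.continuousAt.preimage_mem_nhds (hW.mem_nhds hfW)), fun f hf hf' => ?_⟩
    exact Set.disjoint_left.1 hdisj hf'.1 hf.2
  have hlate : ∀ᶠ k in Filter.atTop, ε k * (‖f₀‖ + 1) < ‖L f₀‖ / 2 := by
    have := hε.mul_const (‖f₀‖ + 1)
    rw [zero_mul] at this
    exact this.eventually_lt_const (by positivity)
  obtain ⟨K, hK⟩ := Filter.eventually_atTop.1 hlate
  choose! U hU hU' using hsep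
  -- Finitely many `k < K` are excluded by the sets `U k`. For later `k`, `‖L ((T ^ k) f)‖` is below
  -- `‖L f₀‖ / 2`, whereas `L` stays at least that large in norm on the ball of radius `r`; its
  -- continuity is the case `k = 0` of `hL`.
  set r : ℝ := min 1 (‖L f₀‖ / (2 * (|ε 0| + 1))) with hr
  have hr0 : 0 < r := by positivity
  have hV : (⋂ k ∈ Finset.Ico 1 K, U k) ∩ Metric.ball f₀ r ∈ nhds f₀ :=
    Filter.inter_mem ((Filter.biInter_finset_mem _).2 fun k hk => hU k (Finset.mem_Ico.1 hk).1)
      (Metric.ball_mem_nhds _ hr0)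
  obtain ⟨V, hVsub, hVo, hfV⟩ := mem_nhds_iff.1 hV
  obtain ⟨k, hk, f, hf, hf'⟩ := hT V hVo ⟨f₀, hfV⟩
  have h1 := hVsub hf
  have h2 := hVsub hf'
  rcases lt_or_ge k K with hkK | hkK
  · have hmem : k ∈ Finset.Ico 1 K := Finset.mem_Ico.2 ⟨hk, hkK⟩
    exact hU' k hk f (Set.mem_iInter₂.1 h1.1 k hmem) (Set.mem_iInter₂.1 h2.1 k hmem)
  · have hfn : ‖f‖ ≤ ‖f₀‖ + 1 := by
      have h3 := mem_ball_iff_norm.1 h1.2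
      have h4 := norm_add_le f₀ (f - f₀)
      rw [add_sub_cancel] at h4
      linarith [min_le_left 1 (‖L f₀‖ / (2 * (|ε 0| + 1)))]
    have h5 := hK k hkK
    have h6 := hL k f
    have h7 := hL 0 (f₀ - (T ^ k) f)
    rw [pow_zero, one_apply_eq_self, hsub] at h7
    have h8 : ‖f₀ - (T ^ k) f‖ < r := by
      rw [norm_sub_rev]; exact mem_ball_iff_norm.1 h2.2
    have h9 : ε 0 * ‖f₀ - (T ^ k) f‖ ≤ ‖L f₀‖ / 2 := by
      calc ε 0 * ‖f₀ - (T ^ k) f‖ ≤ (|ε 0| + 1) * r := by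
            have := le_abs_self (ε 0)
            gcongr
            linarith
        _ ≤ (|ε 0| + 1) * (‖L f₀‖ / (2 * (|ε 0| + 1))) := by
            gcongr
            exact min_le_right _ _
        _ = ‖L f₀‖ / 2 := by field_simp
    have h10 := norm_sub_norm_le (L f₀) (L ((T ^ k) f))
    have h11 : ‖L ((T ^ k) f)‖ < ‖L f₀‖ / 2 := by
      rcases le_or_gt 0 (ε k) with h | h
      · exact (h6.trans (mul_le_mul_of_nonneg_left hfn h)).trans_lt h5
      · have := mul_nonpos_of_nonpos_of_nonneg h.le (norm_nonneg f)
        linarith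
    linarith

/-! ### Derivatives in the half-plane along the orbit of `1`. -/

namespace Dirichlet

lemma norm_coeff_mul_weight_le {ν : ℝ} (f : Space ν) (n : ℕ) :
    ‖coeff f n‖ * weight ν n ≤ ‖f‖ := by
  refine abs_le_of_sq_le_sq' ?_ (norm_nonneg f) |>.2
  rw [mul_pow, norm_sq_eq]
  exact (summable_coeff f).le_tsum n fun k _ => by positivity

/-- Coefficients are at most `‖f‖ (n + 1) ^ q`, and `(n + 1) ^ q ≤ q! * (n + q).choose q` reduces
the sum to the binomial series of `(1 - ‖z‖) ^ (-(q + 1))`. -/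
lemma exists_norm_apply_le (ν : ℝ) :
    ∃ (q : ℕ) (B : ℝ), 0 ≤ B ∧
      ∀ (f : Space ν) (z : 𝔻), ‖f z‖ ≤ B * ‖f‖ * (1 / (1 - ‖(z : ℂ)‖)) ^ (q + 1) := by
  obtain ⟨q, hq⟩ := exists_weight_inv_le ν
  refine ⟨q, q.factorial, by positivity, fun f z => ?_⟩
  have hz := z.norm_lt_one
  have hs := (hasSum_choose_mul_geometric_of_norm_lt_one q
    (by rwa [norm_norm] : ‖‖(z : ℂ)‖‖ < 1)).mul_left (q.factorial * ‖f‖)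
  rw [← (hasTaylor_coeff f z).tsum_eq, one_div_pow]
  refine tsum_of_norm_bounded hs fun n => ?_
  have h1 : ‖coeff f n‖ ≤ ‖f‖ * ((n : ℝ) + 1) ^ q := by
    have h2 := norm_coeff_mul_weight_le f n
    rw [← le_div_iff₀ (weight_pos ν n), div_eq_mul_inv] at h2
    exact h2.trans (mul_le_mul_of_nonneg_left (hq n) (norm_nonneg f))
  have h3 : ((n : ℝ) + 1) ^ q ≤ q.factorial * (n + q).choose q := by
    have := Nat.pow_succ_le_ascFactorial (n + 1) q
    have e := Nat.ascFactorial_eq_factorial_mul_choose n q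
    rw [e] at this
    exact_mod_cast this
  rw [norm_mul, norm_pow]
  calc ‖coeff f n‖ * ‖(z : ℂ)‖ ^ n
      ≤ (‖f‖ * (q.factorial * (n + q).choose q)) * ‖(z : ℂ)‖ ^ n := by
        gcongr
        exact h1.trans (by gcongr)
    _ = _ := by ring

/-- The function on the right half-plane corresponding to a function on the disk. -/
noncomputable def toHalfPlane (η : ℂ) (f : 𝔻 → ℂ) (u : ℂ) : ℂ :=
  extend f (η * ((u - 1) / (u + 1)))

lemma isOpen_re_pos : IsOpen {u : ℂ | 0 < u.re} := isOpen_lt continuous_const Complex.continuous_re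

lemma add_one_ne_zero_of_re_pos {u : ℂ} (hu : 0 < u.re) : u + 1 ≠ 0 := fun h => by
  have := congrArg Complex.re h
  simp at this
  linarith

section HalfPlane

variable {η a : ℂ}

lemma HasTaylor.differentiableOn_toHalfPlane (hη : ‖η‖ = 1) {f : 𝔻 → ℂ} {x : ℕ → ℂ}
    (hx : HasTaylor f x) : DifferentiableOn ℂ (toHalfPlane η f) {u | 0 < u.re} := by
  refine hx.differentiableOn_extend.comp ?_ fun u hu => by
    simpa only [mem_ball_zero_iff] using norm_cayley_symm_lt_one hη hu
  exact (DifferentiableOn.div (by fun_prop) (by fun_prop)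
    fun u hu => add_one_ne_zero_of_re_pos hu).const_mul η

lemma toHalfPlane_comp {φ : 𝔻 → 𝔻} (hη : ‖η‖ = 1) (ha : 0 < a.re)
    (hφ : ∀ z : 𝔻, (η + φ z) / (η - φ z) = (η + z) / (η - z) + a) (f : 𝔻 → ℂ) {u : ℂ}
    (hu : 0 < u.re) : toHalfPlane η (fun z => f (φ z)) u = toHalfPlane η f (u + a) := by
  have hu' : 0 < (u + a).re := by rw [Complex.add_re]; linarith
  rw [toHalfPlane, toHalfPlane, extend_of_lt _ (norm_cayley_symm_lt_one hη hu),
    extend_of_lt _ (norm_cayley_symm_lt_one hη hu')]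
  congr 1
  apply cayley_injective hη
  rw [hφ, Complex.UnitDisc.coe_mk, Complex.UnitDisc.coe_mk, cayley_cayley_symm hη hu,
    cayley_cayley_symm hη hu']

lemma toHalfPlane_pow {ν : ℝ} {φ : 𝔻 → 𝔻} (hη : ‖η‖ = 1) (ha : 0 < a.re)
    (hφ : ∀ z : 𝔻, (η + φ z) / (η - φ z) = (η + z) / (η - z) + a) {C : Space ν →L[ℂ] Space ν}
    (hC : ∀ (f : Space ν) (z : 𝔻), C f z = f (φ z)) (k : ℕ) (f : Space ν) {u : ℂ}
    (hu : 0 < u.re) : toHalfPlane η ((C ^ k) f) u = toHalfPlane η f (u + k * a) := by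
  induction k generalizing u with
  | zero => simp
  | succ k ih =>
    have e : ((C ^ (k + 1)) f : 𝔻 → ℂ) = fun z => ((C ^ k) f) (φ z) := by
      funext z
      rw [pow_succ', mul_apply_eq_comp, hC]
    rw [e, toHalfPlane_comp hη ha hφ _ hu, ih (by rw [Complex.add_re]; linarith)]
    congr 1
    push_cast
    ring

/-- High derivatives of the functions in the half-plane model decay along the orbit of `1`. -/
lemma exists_norm_iteratedDeriv_le (ν : ℝ) (hη : ‖η‖ = 1) (ha : 0 < a.re) :
    ∃ (m : ℕ) (B : ℝ), ∀ (f : Space ν) (k : ℕ),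
      ‖iteratedDeriv m (toHalfPlane η f) (1 + k * a)‖ ≤ B * (1 / ((k : ℝ) + 1)) * ‖f‖ := by
  obtain ⟨q, B, hB, hf⟩ := exists_norm_apply_le ν
  set D : ℝ := 3 + 2 * ‖a‖ with hD
  set ρ : ℝ := min 1 a.re / 2 with hρ
  have hρ0 : 0 < ρ := by
    have := lt_min one_pos ha
    positivity
  have hD0 : 0 < D := by positivity
  -- One order more than the growth exponent `q + 1`, so that a factor `1 / (k + 1)` survives.
  refine ⟨q + 2, (q + 2).factorial * B * (D ^ 2 / (2 * ρ)) ^ (q + 1) / ρ ^ (q + 2),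
    fun f k => ?_⟩
  -- Half the real part of the centre: the disk stays in `R ≤ u.re`, and `R` is at least of order `k
  -- + 1`.
  set R : ℝ := (1 + k * a.re) / 2 with hR
  have hk : (0 : ℝ) ≤ k := k.cast_nonneg
  have hρR : ρ * (k + 1) ≤ R := by
    have h1 := min_le_left 1 a.re
    have h2 := mul_le_mul_of_nonneg_left (min_le_right 1 a.re) hk
    rw [hρ, hR]
    linarith
  have hR0 : 0 < R := lt_of_lt_of_le (by positivity) hρR
  have hre : ∀ u ∈ Metric.closedBall (1 + k * a) R, R ≤ u.re := by
    intro u hu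
    have h1 := Complex.abs_re_le_norm (u - (1 + k * a))
    have h2 := mem_closedBall_iff_norm.1 hu
    have h3 := neg_abs_le (u - (1 + k * a)).re
    have e : (u - (1 + k * a)).re = u.re - 2 * R := by
      simp [hR]
      ring
    linarith
  have hdiff : DiffContOnCl ℂ (toHalfPlane η f) (Metric.ball (1 + k * a) R) :=
    (((hasTaylor_coeff f).differentiableOn_toHalfPlane hη).mono fun u hu =>
      hR0.trans_le (hre u (Metric.closure_ball_subset_closedBall hu))).diffContOnCl
  have hbound : ∀ u ∈ Metric.sphere (1 + k * a) R, ‖toHalfPlane η f u‖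
      ≤ B * ‖f‖ * (D ^ 2 / (2 * ρ) * (k + 1)) ^ (q + 1) := by
    intro u hu
    have hu1 := hre u (Metric.sphere_subset_closedBall hu)
    have hu0 : 0 < u.re := hR0.trans_le hu1
    have hlt := norm_cayley_symm_lt_one hη hu0
    have hnorm : ‖u + 1‖ ≤ D * (k + 1) := by
      have h1 : ‖u + 1‖ ≤ ‖u - (1 + k * a)‖ + ‖(2 : ℂ) + k * a‖ := by
        refine le_trans (le_of_eq ?_) (norm_add_le _ _)
        congr 1; ring
      have h2 : ‖(2 : ℂ) + k * a‖ ≤ 2 + k * ‖a‖ := by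
        refine (norm_add_le _ _).trans (le_of_eq ?_)
        rw [norm_mul, Complex.norm_natCast]
        simp
      have h3 := mem_sphere_iff_norm.1 hu
      have h4 : k * a.re ≤ k * ‖a‖ := mul_le_mul_of_nonneg_left (Complex.re_le_norm a) hk
      have h5 : 0 ≤ k * ‖a‖ := by positivity
      have h6 := norm_nonneg a
      rw [h3, hR] at h1
      rw [hD]
      nlinarith
    have hpos1 : 0 < ‖u + 1‖ := norm_pos_iff.2 (add_one_ne_zero_of_re_pos hu0)
    -- With `z` the disk point of `u`, `1 - ‖z‖ ≥ (1 - ‖z‖²) / 2 = 2 u.re / ‖u + 1‖²`, where `u.re`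
    -- is at least of order `k + 1` and `‖u + 1‖` at most of that order.
    have hinv : 1 / (1 - ‖η * ((u - 1) / (u + 1))‖) ≤ D ^ 2 / (2 * ρ) * (k + 1) := by
      have h1 := one_sub_normSq_cayley_symm hη hu0
      have h2 : 4 * u.re / ‖u + 1‖ ^ 2 ≤ 2 * (1 - ‖η * ((u - 1) / (u + 1))‖) := by
        rw [← h1]
        nlinarith [norm_nonneg (η * ((u - 1) / (u + 1)))]
      have h3 : 4 * (ρ * (k + 1)) / (D * (k + 1)) ^ 2 ≤ 4 * u.re / ‖u + 1‖ ^ 2 := by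
        gcongr
        linarith
      have h4 : 2 * ρ / (D ^ 2 * (k + 1)) ≤ 1 - ‖η * ((u - 1) / (u + 1))‖ := by
        have e : 4 * (ρ * (k + 1)) / (D * (k + 1)) ^ 2 = 2 * (2 * ρ / (D ^ 2 * (k + 1))) := by
          field_simp
          norm_num
        linarith
      calc _ ≤ 1 / (2 * ρ / (D ^ 2 * (k + 1))) := one_div_le_one_div_of_le (by positivity) h4
        _ = _ := by field_simp
    rw [toHalfPlane, extend_of_lt _ hlt]
    refine (hf f _).trans ?_
    rw [Complex.UnitDisc.coe_mk]
    have : 0 ≤ 1 / (1 - ‖η * ((u - 1) / (u + 1))‖) := by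
      apply one_div_nonneg.2; linarith
    gcongr
  refine (Complex.norm_iteratedDeriv_le_of_forall_mem_sphere_norm_le (q + 2) hR0 hdiff
    hbound).trans ?_
  calc _ ≤ (q + 2).factorial * (B * ‖f‖ * (D ^ 2 / (2 * ρ) * (k + 1)) ^ (q + 1))
          / (ρ * (k + 1)) ^ (q + 2) := by gcongr
    _ = _ := by
      rw [mul_pow, mul_pow, pow_succ ((k : ℝ) + 1) (q + 1)]
      field_simp

lemma iteratedDeriv_toHalfPlane_sub (hη : ‖η‖ = 1) {ν : ℝ} (m : ℕ) (f g : Space ν) :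
    iteratedDeriv m (toHalfPlane η (f - g : Space ν)) 1
      = iteratedDeriv m (toHalfPlane η f) 1 - iteratedDeriv m (toHalfPlane η g) 1 := by
  have h1 : {u : ℂ | 0 < u.re} ∈ nhds (1 : ℂ) := isOpen_re_pos.mem_nhds (by simp)
  have hc : ∀ f : Space ν, ContDiffAt ℂ m (toHalfPlane η f) 1 := fun f =>
    (((hasTaylor_coeff f).differentiableOn_toHalfPlane hη).analyticAt h1).contDiffAt
  rw [← iteratedDeriv_sub (hc f) (hc g)]
  congr 1
  funext u
  simp only [toHalfPlane, extend, Pi.sub_apply]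
  split_ifs
  · rfl
  · simp

/-- The polynomial `1 - z / η` becomes `2 / (u + 1)`, none of whose derivatives vanishes at `1`. -/
lemma exists_iteratedDeriv_toHalfPlane_ne_zero (hη : ‖η‖ = 1) (ν : ℝ) (m : ℕ) :
    ∃ f : Space ν, iteratedDeriv m (toHalfPlane η f) 1 ≠ 0 := by
  have hη0 : η ≠ 0 := fun h => by simp [h] at hη
  set c : ℕ → ℂ := fun n => if n = 0 then 1 else if n = 1 then -η⁻¹ else 0 with hc
  have hc0 : ∀ n ∉ Finset.range 2, c n = 0 := fun n hn => by
    rw [Finset.mem_range] at hn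
    simp only [hc]
    rw [if_neg (by omega), if_neg (by omega)]
  have hT : HasTaylor (fun z => 1 - z / η) c := fun z => by
    have h : HasSum (fun n => c n * (z : ℂ) ^ n) (∑ n ∈ Finset.range 2, c n * (z : ℂ) ^ n) :=
      hasSum_sum_of_ne_finset_zero fun n hn => by rw [hc0 n hn, zero_mul]
    have e : ∑ n ∈ Finset.range 2, c n * (z : ℂ) ^ n = 1 - z / η := by
      simp [Finset.sum_range_succ, hc]
      ring
    rwa [e] at h
  have hs : Summable fun n => ‖c n‖ ^ 2 * weight ν n ^ 2 :=
    summable_of_ne_finset_zero (s := Finset.range 2) fun n hn => by simp [hc0 n hn]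
  obtain ⟨f, hf⟩ : ∃ f : Space ν, ∀ z : 𝔻, f z = 1 - z / η := ⟨⟨_, c, hT, hs⟩, fun _ => rfl⟩
  refine ⟨f, ?_⟩
  have hev : toHalfPlane η f =ᶠ[nhds 1] fun u => 2 * (1 * u + 1)⁻¹ := by
    filter_upwards [isOpen_re_pos.mem_nhds (show (1 : ℂ) ∈ {u : ℂ | 0 < u.re} by simp)] with u hu
    have hne := add_one_ne_zero_of_re_pos hu
    rw [toHalfPlane, extend_of_lt _ (norm_cayley_symm_lt_one hη hu), hf, Complex.UnitDisc.coe_mk]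
    field_simp
    ring
  rw [hev.iteratedDeriv_eq, iteratedDeriv_const_mul_field, iteratedDeriv_eq_iterate,
    iter_deriv_inv_linear]
  have h2 : (1 : ℂ) * 1 + 1 ≠ 0 := by norm_num
  have := zpow_ne_zero (-1 - (m : ℤ)) h2
  simp only [one_pow, mul_one]
  refine mul_ne_zero two_ne_zero (mul_ne_zero (mul_ne_zero ?_ ?_) ?_)
  · exact pow_ne_zero _ (by norm_num)
  · exact_mod_cast m.factorial_ne_zero
  · simpa using this

end HalfPlane

end Dirichlet

theorem mainTheorem1 (ν : ℝ) (φ : 𝔻 → 𝔻) (hφ : IsParabolicLFT φ)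
    (hna : ¬ IsDiskAutomorphism φ) :
    ∃ C : Dirichlet.Space ν →L[ℂ] Dirichlet.Space ν,
      (∀ (f : Dirichlet.Space ν) (z : 𝔻), C f z = f (φ z)) ∧ ¬ IsRecurrent C := by
  obtain ⟨η, a, hη, ha, h⟩ := hφ.exists_cayley_translation hna
  obtain ⟨C, hC⟩ := Dirichlet.exists_compositionOperator ν hη ha h
  obtain ⟨m, B, hB⟩ := Dirichlet.exists_norm_iteratedDeriv_le ν hη ha
  obtain ⟨f₀, hf₀⟩ := Dirichlet.exists_iteratedDeriv_toHalfPlane_ne_zero hη ν m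
  refine ⟨C, hC, not_isRecurrent_of_tendsto
    (L := fun f => iteratedDeriv m (Dirichlet.toHalfPlane η f) 1)
    (ε := fun k => B * (1 / ((k : ℝ) + 1))) ?_ (fun k f => ?_)
    (Dirichlet.iteratedDeriv_toHalfPlane_sub hη m) hf₀⟩
  · simpa using (tendsto_one_div_add_atTop_nhds_zero_nat (𝕜 := ℝ)).const_mul B
  · have hev : Dirichlet.toHalfPlane η ((C ^ k) f) =ᶠ[nhds 1]
        fun u => Dirichlet.toHalfPlane η f (u + k * a) := by
      filter_upwards [Dirichlet.isOpen_re_pos.mem_nhds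
        (show (1 : ℂ) ∈ {u : ℂ | 0 < u.re} by simp)] with u hu
      exact Dirichlet.toHalfPlane_pow hη ha h hC k f hu
    rw [hev.iteratedDeriv_eq, iteratedDeriv_comp_add_const]
    exact hB f k
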